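/- Let $d\ge 1$, let $R,S$ be finite subsets of $\mathbb{N}_0^d\setminus\{\mathbf 0\}$, let $(\phi_{\mathbf n})_{\mathbf n\in R}$, $(\theta_{\mathbf n})_{\mathbf n\in S}$ be complex numbers, and put $\Phi(\mathbf z)=1-\sum_{\mathbf n\in R}\phi_{\mathbf n}\mathbf z^{\mathbf n}$, $\Theta(\mathbf z)=1+\sum_{\mathbf n\in S}\theta_{\mathbf n}\mathbf z^{\mathbf n}$ for $\mathbf z\in\mathbb{C}^d$. Let $(Z_{\mathbf t})_{\mathbf t\in\mathbb{Z}^d}$ be i.i.d. complex-valued random variables on a probability space which are symmetric ($Z_{\mathbf 0}$ and $-Z_{\mathbf 0}$ have the same law) and nondeterministic (not almost surely equal to a constant). A random field $(Y_{\mathbf t})_{\mathbf t\in\mathbb{Z}^d}$ on the same probability space is called a causal solution of the ARMA equation if it is strictly stationary, if for every $\mathbf t\in\mathbb{Z}^d$ $$Y_{\mathbf t}-\sum_{\mathbf n\in R}\phi_{\mathbf n}Y_{\mathbf t-\mathbf n}=Z_{\mathbf t}+\sum_{\mathbf n\in S}\theta_{\mathbf n}Z_{\mathbf t-\mathbf n}\quad\text{almost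 surely},$$ and if $Y_{\mathbf t}$ is measurable with respect to $\sigma(Z_{\mathbf s}:\mathbf s\le\mathbf t)$ for every $\mathbf t$, where $\le$ is the coordinatewise order. It is called symmetric if $Y_{\mathbf 0}$ and $-Y_{\mathbf 0}$ have the same law. Let $\mathbb{D}^d=\{\mathbf z\in\mathbb{C}^d:|z_i|<1,\ i=1,\dots,d\}$ and let $H^2$ be the space of holomorphic functions $f:\mathbb{D}^d\to\mathbb{C}$ with $\sup_{0\le r<1}(2\pi)^{-d}\int_{(-\pi,\pi]^d}|f(re^{-it_1},\dots,re^{-it_d})|^2\,d\mathbf t<\infty$. We write $\Theta/\Phi\in H^2$ if there is $f\in H^2$ with $f(\mathbf z)=\Theta(\mathbf z)/\Phi(\mathbf z)$ for all $\mathbf z\in\mathbb{D}^d$ with $\Phi(\mathbf z)\ne0$ (this $f$ is then unique), and in that case $(\alpha_{\mathbf k})_{\mathbf k\in\mathbb{N}_0^d}$ denotes the coefficients of its power series expansion $f(\mathbf z)=\sum_{\mathbf k\in\mathbb{N}_0^d}\alpha_{\mathbf k}\mathbf z^{\mathbf k}$, $\mathbf z\in\mathbb{D}^d$. A multiple series $\sum_{\mathbf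 k\in\mathbb{N}_0^d}X_{\mathbf k}$ of random variables converges almost surely in the rectangular sense if, almost surely, the partial sums $\sum_{k_1=0}^{N_1}\cdots\sum_{k_d=0}^{N_d}X_{\mathbf k}$ converge to a limit in $\mathbb{C}$ as $\min(N_1,\dots,N_d)\to\infty$; this limit is the value of the series (put equal to $0$ on the null set where it does not exist). Then the ARMA equation admits a causal solution if and only if $\Theta/\Phi\in H^2$ and, for every $\mathbf t\in\mathbb{Z}^d$, the series $\sum_{\mathbf k\in\mathbb{N}_0^d}\alpha_{\mathbf k}Z_{\mathbf t-\mathbf k}$ converges almost surely in the rectangular sense. In that case $$Y_{\mathbf t}:=\sum_{\mathbf k\in\mathbb{N}_0^d}\alpha_{\mathbf k}Z_{\mathbf t-\mathbf k},\quad\mathbf t\in\mathbb{Z}^d,$$ defines a symmetric causal solution, and it is the unique one: every symmetric causal solution $(Y'_{\mathbf t})$ satisfies $Y'_{\mathbf t}=Y_{\mathbf t}$ almost surely for every $\mathbf t\in\mathbb{Z}^d$. -/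

import Mathlib

open MeasureTheory ProbabilityTheory Filter Topology

namespace SpatialARMA

/-- The monomial `z ^ n = ∏ i, z_i ^ n_i`. -/
def monomial {d : ℕ} (z : Fin d → ℂ) (n : Fin d → ℕ) : ℂ := ∏ i, z i ^ n i

/-- The lattice point `t - n`, for `t ∈ ℤ^d` and `n ∈ ℕ₀^d`. -/
def back {d : ℕ} (t : Fin d → ℤ) (n : Fin d → ℕ) : Fin d → ℤ := fun i => t i - (n i : ℤ)

/-- The autoregressive polynomial `Φ(z) = 1 - ∑_{n ∈ R} φ_n z^n`. -/
def arPoly {d : ℕ} (R : Finset (Fin d → ℕ)) (φ : (Fin d → ℕ) → ℂ) (z : Fin d → ℂ) : ℂ :=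
  1 - ∑ n ∈ R, φ n * monomial z n

/-- The moving average polynomial `Θ(z) = 1 + ∑_{n ∈ S} θ_n z^n`. -/
def maPoly {d : ℕ} (S : Finset (Fin d → ℕ)) (θ : (Fin d → ℕ) → ℂ) (z : Fin d → ℂ) : ℂ :=
  1 + ∑ n ∈ S, θ n * monomial z n

/-- The open unit polydisc `𝔻^d`. -/
def polydisc (d : ℕ) : Set (Fin d → ℂ) := {z | ∀ i, ‖z i‖ < 1}

/-- The square of the Hardy norm,
`sup_{0 ≤ r < 1} (2π)^{-d} ∫_{(-π, π]^d} |f(r e^{-it})|² dt`, as an extended nonnegative number. -/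
noncomputable def hardyNormSq {d : ℕ} (f : (Fin d → ℂ) → ℂ) : ENNReal :=
  ⨆ r ∈ Set.Ico (0 : ℝ) 1,
    ENNReal.ofReal ((2 * Real.pi) ^ d)⁻¹ *
      ∫⁻ t in Set.pi Set.univ (fun _ : Fin d => Set.Ioc (-Real.pi) Real.pi),
        ‖f (fun i => (r : ℂ) * Complex.exp (-(Complex.I * (t i : ℂ))))‖ₑ ^ 2

/-- Membership in the Hardy space `H²` of the polydisc (only the values on `𝔻^d` matter). -/
def MemHardy {d : ℕ} (f : (Fin d → ℂ) → ℂ) : Prop :=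
  DifferentiableOn ℂ f (polydisc d) ∧ hardyNormSq f < ⊤

/-- `f` is the quotient `Θ / Φ` as a (holomorphic) function on `𝔻^d`: it equals `Θ(z) / Φ(z)` at all
points of the polydisc with `Φ(z) ≠ 0`. This set is open and dense in `𝔻^d` since `Φ(0) = 1`. -/
def IsQuotient {d : ℕ} (R S : Finset (Fin d → ℕ)) (φ θ : (Fin d → ℕ) → ℂ)
    (f : (Fin d → ℂ) → ℂ) : Prop :=
  ∀ z ∈ polydisc d, arPoly R φ z ≠ 0 → f z = maPoly S θ z / arPoly R φ z

/-- `f(z) = ∑_{k ∈ ℕ₀^d} α_k z^k` for all `z ∈ 𝔻^d`. -/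
def HasExpansion {d : ℕ} (f : (Fin d → ℂ) → ℂ) (α : (Fin d → ℕ) → ℂ) : Prop :=
  ∀ z ∈ polydisc d, HasSum (fun k => α k * monomial z k) (f z)

/-- The rectangular partial sum `∑_{k_1=0}^{N_1} ⋯ ∑_{k_d=0}^{N_d} x_k`. -/
def rectPartialSum {d : ℕ} (x : (Fin d → ℕ) → ℂ) (N : Fin d → ℕ) : ℂ :=
  ∑ k ∈ Finset.Iic N, x k

/-- The multiple series `∑_{k ∈ ℕ₀^d} x_k` converges to `l` in the rectangular sense. The filter
`atTop` on `Fin d → ℕ` expresses `min (N_1, …, N_d) → ∞`. -/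
def HasRectSum {d : ℕ} (x : (Fin d → ℕ) → ℂ) (l : ℂ) : Prop :=
  Tendsto (rectPartialSum x) atTop (𝓝 l)

open Classical in
/-- The rectangular sum of a multiple series, set to `0` where the series does not converge in the
rectangular sense. -/
noncomputable def rectSum {d : ℕ} (x : (Fin d → ℕ) → ℂ) : ℂ :=
  if h : ∃ l, HasRectSum x l then h.choose else 0

/-- Almost sure convergence in the rectangular sense of a random multiple series. -/
def ConvergesRectAS {d : ℕ} {Ω : Type*} [MeasurableSpace Ω] (μ : Measure Ω)
    (X : (Fin d → ℕ) → Ω → ℂ) : Prop :=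
  ∀ᵐ ω ∂μ, ∃ l, HasRectSum (fun k => X k ω) l

/-- The ARMA equation, for every `t ∈ ℤ^d`, almost surely. -/
def SolvesARMA {d : ℕ} {Ω : Type*} [MeasurableSpace Ω] (μ : Measure Ω)
    (R S : Finset (Fin d → ℕ)) (φ θ : (Fin d → ℕ) → ℂ) (Z Y : (Fin d → ℤ) → Ω → ℂ) : Prop :=
  ∀ t, ∀ᵐ ω ∂μ,
    Y t ω - ∑ n ∈ R, φ n * Y (back t n) ω = Z t ω + ∑ n ∈ S, θ n * Z (back t n) ω

/-- Strict stationarity: the law of the field is invariant under all shifts of `ℤ^d`. -/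
def StrictlyStationary {d : ℕ} {Ω : Type*} [MeasurableSpace Ω] (μ : Measure Ω)
    (Y : (Fin d → ℤ) → Ω → ℂ) : Prop :=
  ∀ h : Fin d → ℤ, IdentDistrib (fun ω t => Y (t + h) ω) (fun ω t => Y t ω) μ μ

/-- The σ-algebra `σ(Z_s : s ≤ t)`, where `≤` is the coordinatewise order of `ℤ^d`. -/
@[reducible]
noncomputable def past {d : ℕ} {Ω : Type*} (Z : (Fin d → ℤ) → Ω → ℂ) (t : Fin d → ℤ) : MeasurableSpace Ω :=
  ⨆ s ∈ Set.Iic t, MeasurableSpace.comap (Z s) inferInstance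

/-- A causal solution of the ARMA equation: a strictly stationary solution such that `Y_t` is
`σ(Z_s : s ≤ t)`-measurable for every `t`. -/
structure IsCausalSolution {d : ℕ} {Ω : Type*} [MeasurableSpace Ω] (μ : Measure Ω)
    (R S : Finset (Fin d → ℕ)) (φ θ : (Fin d → ℕ) → ℂ) (Z Y : (Fin d → ℤ) → Ω → ℂ) : Prop where
  stationary : StrictlyStationary μ Y
  solves : SolvesARMA μ R S φ θ Z Y
  causal : ∀ t, Measurable[past Z t] (Y t)

/-- The field consists of independent, identically distributed random variables. -/
structure IsIIDNoise {d : ℕ} {Ω : Type*} [MeasurableSpace Ω] (μ : Measure Ω)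
    (Z : (Fin d → ℤ) → Ω → ℂ) : Prop where
  measurable : ∀ t, Measurable (Z t)
  indep : iIndepFun Z μ
  ident : ∀ s t, IdentDistrib (Z s) (Z t) μ μ

/-- The field is deterministic: all its members are almost surely equal to one constant. -/
def IsDeterministic {d : ℕ} {Ω : Type*} [MeasurableSpace Ω] (μ : Measure Ω)
    (Z : (Fin d → ℤ) → Ω → ℂ) : Prop :=
  ∃ K : ℂ, ∀ t, ∀ᵐ ω ∂μ, Z t ω = K

/-- The (one-dimensional marginal) law of a stationary field is symmetric: `X_0` and `-X_0` have
the same law. -/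
def IsSymmetric {d : ℕ} {Ω : Type*} [MeasurableSpace Ω] (μ : Measure Ω)
    (X : (Fin d → ℤ) → Ω → ℂ) : Prop :=
  IdentDistrib (X 0) (fun ω => -X 0 ω) μ μ

end SpatialARMA

namespace SpatialARMA

/-! Because `0 ∉ R`, the formal identity `Φ · ∑ α_k z^k = Θ` determines `α` recursively. Iterating
the ARMA equation inside a box writes any causal solution as `∑_{k ≤ N} α_k Z_{t-k}` plus a
remainder built from `Y` and `Z` at points `t - j` with `¬ j ≤ N`. By causality the remainder
depends, up to null sets, only on the noise outside the box, so it is independent of the partial sum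
(`IsCausalSolution.exists_indepFun_remainder`).

Necessity comes from this splitting alone. For the real and imaginary parts, the characteristic
function of `Y_t` is at least `1/2` in modulus near `0`, and it is dominated there by every finite
product of the real characteristic functions of the terms. This bounds the truncated second moments:
`∑ E min(1, |α_k Z_{t-k}|²) < ∞` (`summable_integral_min_one_sq`). As `Z` is not almost surely `0`,
it follows that `∑ |α_k|² < ∞`, hence `Θ/Φ ∈ H²` by Parseval and Fatou. The same bound gives
rectangular convergence, through a Lévy maximal inequality over boxes with constant `2^d`
(`levy_mixIndex`) and Borel–Cantelli.

For sufficiency, the coefficients of `Θ/Φ` satisfy the recursion (`IsQuotient.isRecursive`), and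
letting the box grow in a finite summation identity shows that the series solves the equation.
Stationarity and symmetry pass from the noise to a measurable functional of it.

For uniqueness, two causal solutions have the same partial sums, so their difference is independent
of the noise in every box, hence of the whole past, with respect to which it is measurable. It is
therefore constant, and symmetry makes the constant `0`. -/

/-! ### The formal recursion for `Θ/Φ` and its truncation to boxes. -/

/-- The coefficients of `Θ` as a power series. -/
noncomputable def maCoeff {d : ℕ} (S : Finset (Fin d → ℕ)) (θ : (Fin d → ℕ) → ℂ)
    (k : Fin d → ℕ) : ℂ :=
  (if k = 0 then 1 else 0) + ∑ n ∈ S, if k = n then θ n else 0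

open scoped Classical in
/-- `α` satisfies the recursion `Φ · ∑ α_k z^k = Θ` of formal power series. -/
def IsRecursive {d : ℕ} (R S : Finset (Fin d → ℕ)) (φ θ : (Fin d → ℕ) → ℂ)
    (α : (Fin d → ℕ) → ℂ) : Prop :=
  ∀ k, α k = maCoeff S θ k + ∑ n ∈ R, if n ≤ k then φ n * α (k - n) else 0

theorem sub_lt_self_of_le {d : ℕ} {n k : Fin d → ℕ} (hn : n ≠ 0) (hnk : n ≤ k) : k - n < k := by
  refine lt_of_le_of_ne tsub_le_self fun h => hn ?_
  funext i
  have h1 := congrFun h i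
  have h2 : n i ≤ k i := hnk i
  simp only [Pi.sub_apply, Pi.zero_apply] at h1 ⊢
  omega

/-- Nonzero shifts `n` make `k - n` strictly smaller than `k`, so the recursion runs along the
well-founded product order. -/
theorem exists_isRecursive {d : ℕ} {R : Finset (Fin d → ℕ)} (S : Finset (Fin d → ℕ))
    (hR : 0 ∉ R) (φ θ : (Fin d → ℕ) → ℂ) : ∃ α, IsRecursive R S φ θ α := by
  classical
  have wf : WellFounded ((· < ·) : (Fin d → ℕ) → (Fin d → ℕ) → Prop) := wellFounded_lt
  let F : ∀ k : Fin d → ℕ, (∀ j, j < k → ℂ) → ℂ := fun k g =>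
    maCoeff S θ k + ∑ n ∈ R, if h : k - n < k ∧ n ≤ k then φ n * g (k - n) h.1 else 0
  refine ⟨wf.fix F, fun k => ?_⟩
  rw [wf.fix_eq]
  simp only [F]
  congr 1
  refine Finset.sum_congr rfl fun n hn => ?_
  have hn0 : n ≠ 0 := fun h => hR (h ▸ hn)
  by_cases h : n ≤ k
  · rw [dif_pos ⟨sub_lt_self_of_le hn0 h, h⟩, if_pos h]
  · rw [dif_neg fun h' => h h'.2, if_neg h]

theorem le_tsub_iff_add_le {d : ℕ} {j n k : Fin d → ℕ} (hjk : j ≤ k) :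
    n ≤ k - j ↔ j + n ≤ k := by
  simp only [Pi.le_def, Pi.sub_apply, Pi.add_apply]
  refine forall_congr' fun i => ?_
  have : j i ≤ k i := hjk i
  omega

/-- The sum of `α_{k-j} x_k` over `j ≤ k ≤ N`. -/
noncomputable def shiftedSum {d : ℕ} (α x : (Fin d → ℕ) → ℂ) (N j : Fin d → ℕ) : ℂ :=
  ∑ k ∈ Finset.Icc j N, α (k - j) * x k

theorem shiftedSum_of_not_le {d : ℕ} (α x : (Fin d → ℕ) → ℂ) {N j : Fin d → ℕ} (h : ¬ j ≤ N) :
    shiftedSum α x N j = 0 := by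
  rw [shiftedSum, Finset.Icc_eq_empty h, Finset.sum_empty]

theorem shiftedSum_zero {d : ℕ} (α x : (Fin d → ℕ) → ℂ) (N : Fin d → ℕ) :
    shiftedSum α x N 0 = rectPartialSum (fun k => α k * x k) N := by
  have : Finset.Icc 0 N = Finset.Iic N := by ext; simp
  simp [shiftedSum, rectPartialSum, this]

open scoped Classical in
theorem shiftedSum_maCoeff {d : ℕ} (S : Finset (Fin d → ℕ)) (θ x : (Fin d → ℕ) → ℂ)
    (N j : Fin d → ℕ) :
    shiftedSum (maCoeff S θ) x N j = (if j ≤ N then x j else 0) +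
      ∑ n ∈ S, θ n * (if j + n ≤ N then x (j + n) else 0) := by
  simp only [shiftedSum, maCoeff, add_mul, Finset.sum_add_distrib, Finset.sum_mul]
  congr 1
  · split_ifs with h
    · rw [Finset.sum_eq_single j]
      · simp
      · intro k hk hkj
        have hjk := (Finset.mem_Icc.1 hk).1
        rw [if_neg, zero_mul]
        intro h0
        exact hkj (le_antisymm (tsub_eq_zero_iff_le.1 h0) hjk)
      · simp [h]
    · rw [Finset.Icc_eq_empty h, Finset.sum_empty]
  · rw [Finset.sum_comm]
    refine Finset.sum_congr rfl fun n _ => ?_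
    split_ifs with h
    · rw [Finset.sum_eq_single (j + n)]
      · simp
      · intro k hk hkj
        have hjk := (Finset.mem_Icc.1 hk).1
        rw [if_neg, zero_mul]
        rintro rfl
        exact hkj (add_tsub_cancel_of_le hjk).symm
      · intro h'
        exact absurd (Finset.mem_Icc.2 ⟨le_self_add, h⟩) h'
    · rw [mul_zero]
      refine Finset.sum_eq_zero fun k hk => ?_
      rw [if_neg, zero_mul]
      rintro rfl
      obtain ⟨h1, h2⟩ := Finset.mem_Icc.1 hk
      exact h (by rwa [add_tsub_cancel_of_le h1])

-- Multiply the recursion for `α (k - j)` by `x k` and sum over the box: the term `α (k - j - n)`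
-- belongs to the sum started at `j + n`. Thus the truncated sums obey the ARMA equation driven by
-- `x` set to `0` outside the box.
open scoped Classical in
theorem IsRecursive.shiftedSum_eq {d : ℕ} {R S : Finset (Fin d → ℕ)} {φ θ : (Fin d → ℕ) → ℂ}
    {α : (Fin d → ℕ) → ℂ} (hα : IsRecursive R S φ θ α) (x : (Fin d → ℕ) → ℂ)
    (N j : Fin d → ℕ) :
    shiftedSum α x N j = ∑ n ∈ R, φ n * shiftedSum α x N (j + n) +
      ((if j ≤ N then x j else 0) + ∑ n ∈ S, θ n * (if j + n ≤ N then x (j + n) else 0)) := by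
  rw [← shiftedSum_maCoeff]
  have h1 : shiftedSum α x N j = ∑ k ∈ Finset.Icc j N, (maCoeff S θ (k - j) +
      ∑ n ∈ R, if n ≤ k - j then φ n * α (k - j - n) else 0) * x k :=
    Finset.sum_congr rfl fun k _ => by rw [← hα]
  rw [h1]
  simp only [add_mul, Finset.sum_add_distrib, Finset.sum_mul]
  rw [add_comm]
  congr 1
  rw [Finset.sum_comm]
  refine Finset.sum_congr rfl fun n _ => ?_
  rw [shiftedSum, Finset.mul_sum]
  symm
  refine Finset.sum_subset_zero_on_sdiff (fun k hk => ?_) (fun k hk => ?_) (fun k hk => ?_)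
  · obtain ⟨h1, h2⟩ := Finset.mem_Icc.1 hk
    exact Finset.mem_Icc.2 ⟨le_self_add.trans h1, h2⟩
  · obtain ⟨h1, h2⟩ := Finset.mem_sdiff.1 hk
    obtain ⟨h3, h4⟩ := Finset.mem_Icc.1 h1
    rw [if_neg, zero_mul]
    rw [le_tsub_iff_add_le h3]
    exact fun h => h2 (Finset.mem_Icc.2 ⟨h, h4⟩)
  · obtain ⟨h1, h2⟩ := Finset.mem_Icc.1 hk
    rw [if_pos ((le_tsub_iff_add_le (le_self_add.trans h1)).2 h1), mul_assoc, tsub_add_eq_tsub_tsub]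

/-! ### Lattice boxes, their σ-algebras, and the independent remainder. -/

theorem back_add {d : ℕ} (t : Fin d → ℤ) (j n : Fin d → ℕ) :
    back (back t j) n = back t (j + n) := by
  funext i
  simp only [back, Pi.add_apply]
  push_cast
  ring

theorem back_zero {d : ℕ} (t : Fin d → ℤ) : back t 0 = t := by
  funext i
  simp [back]

theorem back_injective {d : ℕ} (t : Fin d → ℤ) : Function.Injective (back t) := by
  intro j k h
  funext i
  have := congrFun h i
  simp only [back] at this
  omega

theorem back_add_shift {d : ℕ} (t h : Fin d → ℤ) (k : Fin d → ℕ) :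
    back (t + h) k = back t k + h := by
  funext i
  simp only [back, Pi.add_apply]
  ring

theorem le_iff_exists_back {d : ℕ} (s t : Fin d → ℤ) : s ≤ t ↔ ∃ k, back t k = s := by
  constructor
  · intro h
    refine ⟨fun i => (t i - s i).toNat, funext fun i => ?_⟩
    have : s i ≤ t i := h i
    simp only [back]
    omega
  · rintro ⟨k, rfl⟩ i
    simp only [back]
    omega

/-- The σ-algebra generated by the members of a field with index in `A`. -/
@[reducible]
noncomputable def fieldSigma {ι Ω : Type*} (Z : ι → Ω → ℂ) (A : Set ι) : MeasurableSpace Ω :=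
  ⨆ s ∈ A, MeasurableSpace.comap (Z s) inferInstance

theorem fieldSigma_mono {ι Ω : Type*} (Z : ι → Ω → ℂ) {A B : Set ι} (h : A ⊆ B) :
    fieldSigma Z A ≤ fieldSigma Z B :=
  biSup_mono h

theorem measurable_fieldSigma {ι Ω : Type*} (Z : ι → Ω → ℂ) {A : Set ι} {s : ι} (hs : s ∈ A) :
    Measurable[fieldSigma Z A] (Z s) :=
  (comap_measurable (Z s)).mono
    (le_biSup (fun s => MeasurableSpace.comap (Z s) inferInstance) hs) le_rfl

theorem fieldSigma_le {ι Ω : Type*} [m : MeasurableSpace Ω] {Z : ι → Ω → ℂ}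
    (hZ : ∀ s, Measurable (Z s)) (A : Set ι) : fieldSigma Z A ≤ m :=
  iSup₂_le fun s _ => (hZ s).comap_le

theorem indep_fieldSigma {ι Ω : Type*} [MeasurableSpace Ω] {μ : Measure Ω} {Z : ι → Ω → ℂ}
    (hZ : ∀ s, Measurable (Z s)) (hi : iIndepFun Z μ) {A B : Set ι} (h : Disjoint A B) :
    Indep (fieldSigma Z A) (fieldSigma Z B) μ :=
  indep_iSup_of_disjoint (fun s => (hZ s).comap_le) hi.iIndep h

/-- The lattice points `t - k` with `k ≤ N`. -/
def nearBox {d : ℕ} (t : Fin d → ℤ) (N : Fin d → ℕ) : Set (Fin d → ℤ) := back t '' Set.Iic N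

theorem back_mem_nearBox {d : ℕ} {t : Fin d → ℤ} {N k : Fin d → ℕ} :
    back t k ∈ nearBox t N ↔ k ≤ N :=
  (back_injective t).mem_set_image

/-- Moving further back from a point that has left the box never re-enters it. -/
theorem past_le_far {d : ℕ} {Ω : Type*} (Z : (Fin d → ℤ) → Ω → ℂ) {t : Fin d → ℤ}
    {N j : Fin d → ℕ} (h : ¬ j ≤ N) : past Z (back t j) ≤ fieldSigma Z (nearBox t N)ᶜ := by
  refine fieldSigma_mono Z fun s hs => ?_
  obtain ⟨k, rfl⟩ := (le_iff_exists_back _ _).1 hs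
  rw [back_add, Set.mem_compl_iff, back_mem_nearBox]
  exact fun h' => h (le_self_add.trans h')

theorem aestronglyMeasurable_finsetSum {ι Ω : Type*} {m m0 : MeasurableSpace Ω} {μ : Measure[m0] Ω}
    (s : Finset ι) {f : ι → Ω → ℂ} (hf : ∀ i ∈ s, AEStronglyMeasurable[m] (f i) μ) :
    AEStronglyMeasurable[m] (fun ω => ∑ i ∈ s, f i ω) μ := by
  classical
  induction s using Finset.induction_on with
  | empty => simpa using aestronglyMeasurable_const
  | insert i s hi ih =>
    simp only [Finset.sum_insert hi]
    exact (hf i (Finset.mem_insert_self i s)).fun_add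
      (ih fun j hj => hf j (Finset.mem_insert_of_mem hj))

/-- Induction from outside the box inwards. Outside, the truncated sum vanishes and causality
suffices. Inside, subtracting `IsRecursive.shiftedSum_eq` from the ARMA equation expresses the
difference at `j` through those at `j + n` and through noise outside the box. The equation holds
only almost surely, hence the almost everywhere form of measurability. -/
theorem IsCausalSolution.sub_shiftedSum_aestronglyMeasurable {d : ℕ} {Ω : Type*}
    [MeasurableSpace Ω] {μ : Measure Ω} {R S : Finset (Fin d → ℕ)} {φ θ α : (Fin d → ℕ) → ℂ}
    {Z Y : (Fin d → ℤ) → Ω → ℂ} (hR : 0 ∉ R)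
    (hY : IsCausalSolution μ R S φ θ Z Y) (hα : IsRecursive R S φ θ α) (t : Fin d → ℤ)
    (N : Fin d → ℕ) (j : Fin d → ℕ) :
    AEStronglyMeasurable[fieldSigma Z (nearBox t N)ᶜ]
      (fun ω => Y (back t j) ω - shiftedSum α (fun k => Z (back t k) ω) N j) μ := by
  classical
  by_cases hj : j ≤ N
  swap
  · have h1 := ((hY.causal (back t j)).mono (past_le_far Z hj) le_rfl).aestronglyMeasurable (μ := μ)
    simpa only [shiftedSum_of_not_le _ _ hj, sub_zero] using h1
  have hZm : ∀ k : Fin d → ℕ, AEStronglyMeasurable[fieldSigma Z (nearBox t N)ᶜ]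
      (fun ω => Z (back t k) ω - if k ≤ N then Z (back t k) ω else 0) μ := fun k => by
    by_cases hk : k ≤ N
    · simp only [if_pos hk, sub_self]
      exact aestronglyMeasurable_const
    · simp only [if_neg hk, sub_zero]
      have hk' : back t k ∈ (nearBox t N)ᶜ := fun h => hk (back_mem_nearBox.1 h)
      exact (measurable_fieldSigma Z hk').aestronglyMeasurable
  have hYm : ∀ n ∈ R, AEStronglyMeasurable[fieldSigma Z (nearBox t N)ᶜ]
      (fun ω => Y (back t (j + n)) ω - shiftedSum α (fun k => Z (back t k) ω) N (j + n)) μ :=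
    fun n hn => IsCausalSolution.sub_shiftedSum_aestronglyMeasurable hR hY hα t N (j + n)
  have key : AEStronglyMeasurable[fieldSigma Z (nearBox t N)ᶜ] (fun ω =>
      ∑ n ∈ R, φ n * (Y (back t (j + n)) ω - shiftedSum α (fun k => Z (back t k) ω) N (j + n)) +
      ((Z (back t j) ω - if j ≤ N then Z (back t j) ω else 0) + ∑ n ∈ S, θ n *
        (Z (back t (j + n)) ω - if j + n ≤ N then Z (back t (j + n)) ω else 0))) μ :=
    (aestronglyMeasurable_finsetSum _ fun n hn => (hYm n hn).const_mul _).fun_add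
      ((hZm j).fun_add (aestronglyMeasurable_finsetSum _ fun n _ => (hZm _).const_mul _))
  refine key.congr ?_
  filter_upwards [hY.solves (back t j)] with ω hω
  simp only [back_add] at hω
  rw [hα.shiftedSum_eq]
  simp only [mul_sub, Finset.sum_sub_distrib]
  linear_combination -hω
-- The `+ 1` keeps each term positive while `j ≤ N`, so a coordinate with `n i ≠ 0` strictly lowers
-- the truncated difference even when `j i = N i`.
termination_by ∑ i, (N i + 1 - j i)
decreasing_by
  have hn0 : n ≠ 0 := fun h => hR (h ▸ hn)
  obtain ⟨i, hi⟩ := Function.ne_iff.1 hn0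
  refine Finset.sum_lt_sum (fun i _ => ?_) ⟨i, Finset.mem_univ i, ?_⟩
  · simp only [Pi.add_apply]
    omega
  · have h1 : j i ≤ N i := hj i
    simp only [Pi.add_apply, Pi.zero_apply] at hi ⊢
    omega

theorem measurable_rectPartialSum_near {d : ℕ} {Ω : Type*} (Z : (Fin d → ℤ) → Ω → ℂ)
    (α : (Fin d → ℕ) → ℂ) (t : Fin d → ℤ) (N : Fin d → ℕ) :
    Measurable[fieldSigma Z (nearBox t N)]
      (fun ω => rectPartialSum (fun k => α k * Z (back t k) ω) N) := by
  unfold rectPartialSum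
  refine Finset.measurable_fun_sum _ fun k hk => Measurable.const_mul ?_ _
  exact measurable_fieldSigma Z (back_mem_nearBox.2 (Finset.mem_Iic.1 hk))

theorem IsCausalSolution.aestronglyMeasurable_remainder {d : ℕ} {Ω : Type*}
    [MeasurableSpace Ω] {μ : Measure Ω} {R S : Finset (Fin d → ℕ)} {φ θ α : (Fin d → ℕ) → ℂ}
    {Z Y : (Fin d → ℤ) → Ω → ℂ} (hR : 0 ∉ R) (hY : IsCausalSolution μ R S φ θ Z Y)
    (hα : IsRecursive R S φ θ α) (t : Fin d → ℤ) (N : Fin d → ℕ) :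
    AEStronglyMeasurable[fieldSigma Z (nearBox t N)ᶜ]
      (fun ω => Y t ω - rectPartialSum (fun k => α k * Z (back t k) ω) N) μ := by
  simpa only [back_zero, shiftedSum_zero] using
    hY.sub_shiftedSum_aestronglyMeasurable hR hα t N 0

/-- A causal solution is the sum of a rectangular partial sum and an independent remainder. -/
theorem IsCausalSolution.exists_indepFun_remainder {d : ℕ} {Ω : Type*}
    [MeasurableSpace Ω] {μ : Measure Ω} {R S : Finset (Fin d → ℕ)} {φ θ α : (Fin d → ℕ) → ℂ}
    {Z Y : (Fin d → ℤ) → Ω → ℂ} (hR : 0 ∉ R) (hZ : IsIIDNoise μ Z)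
    (hY : IsCausalSolution μ R S φ θ Z Y)
    (hα : IsRecursive R S φ θ α) (t : Fin d → ℤ) (N : Fin d → ℕ) :
    ∃ W : Ω → ℂ, Measurable W ∧
      IndepFun (fun ω => rectPartialSum (fun k => α k * Z (back t k) ω) N) W μ ∧
      Y t =ᵐ[μ] fun ω => rectPartialSum (fun k => α k * Z (back t k) ω) N + W ω := by
  have h := hY.aestronglyMeasurable_remainder hR hα t N
  have hm := h.stronglyMeasurable_mk.measurable
  -- The modification `h.mk` is genuinely measurable for the noise outside the box, so exact
  -- independence is available.
  refine ⟨h.mk _, hm.mono (fieldSigma_le hZ.measurable _) le_rfl, ?_, ?_⟩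
  · rw [IndepFun_iff_Indep]
    exact indep_of_indep_of_le_left (indep_of_indep_of_le_right
      (indep_fieldSigma hZ.measurable hZ.indep disjoint_compl_right) hm.comap_le)
      (measurable_rectPartialSum_near Z α t N).comap_le
  · filter_upwards [h.ae_eq_mk] with ω hω
    rw [← hω]
    ring

/-! ### Characteristic functions and truncated second moments. -/

theorem integrable_cos_mul {Ω : Type*} [MeasurableSpace Ω] {μ : Measure Ω} [IsFiniteMeasure μ]
    {X : Ω → ℝ} (hX : Measurable X) (u : ℝ) : Integrable (fun ω => Real.cos (u * X ω)) μ :=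
  Integrable.of_bound (by fun_prop) 1 (ae_of_all _ fun _ => Real.abs_cos_le_one _)

theorem integrable_sin_mul {Ω : Type*} [MeasurableSpace Ω] {μ : Measure Ω} [IsFiniteMeasure μ]
    {X : Ω → ℝ} (hX : Measurable X) (u : ℝ) : Integrable (fun ω => Real.sin (u * X ω)) μ :=
  Integrable.of_bound (by fun_prop) 1 (ae_of_all _ fun _ => Real.abs_sin_le_one _)

/-- The characteristic function of a symmetric random variable is real. -/
theorem charFun_map_of_symmetric {Ω : Type*} [MeasurableSpace Ω] {μ : Measure Ω}
    [IsProbabilityMeasure μ] {X : Ω → ℝ} (hX : Measurable X)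
    (hs : IdentDistrib X (fun ω => -X ω) μ μ) (u : ℝ) :
    charFun (μ.map X) u = ((∫ ω, Real.cos (u * X ω) ∂μ : ℝ) : ℂ) := by
  rw [charFun_apply_real, integral_map hX.aemeasurable (by fun_prop)]
  have hsin : ∫ ω, Real.sin (u * X ω) ∂μ = 0 := by
    have h := (hs.comp (u := fun x => Real.sin (u * x)) (by fun_prop)).integral_eq
    simp only [Function.comp_def, mul_neg, Real.sin_neg, integral_neg] at h
    linarith
  have : ∀ ω, Complex.exp (u * X ω * Complex.I) =
      ((Real.cos (u * X ω) : ℝ) : ℂ) + ((Real.sin (u * X ω) : ℝ) : ℂ) * Complex.I := fun ω => by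
    rw [Complex.exp_mul_I]
    push_cast
    rfl
  simp only [this]
  rw [integral_add (integrable_cos_mul hX u).ofReal
    ((integrable_sin_mul hX u).ofReal.mul_const _), integral_mul_const,
    integral_complex_ofReal, integral_complex_ofReal, hsin]
  simp

/-- Double-angle formula together with `E cos² ≥ (E cos)²`, in the form `2 (cos - c)² ≥ 0`. It is
needed because `|c|` near `1` does not exclude `c` near `-1`; doubling the argument removes this
sign ambiguity. -/
theorem one_sub_integral_cos_two_mul_le {Ω : Type*} [MeasurableSpace Ω] {μ : Measure Ω}
    [IsProbabilityMeasure μ] {X : Ω → ℝ} (hX : Measurable X) (u : ℝ) :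
    1 - ∫ ω, Real.cos (2 * u * X ω) ∂μ ≤ 2 * (1 - (∫ ω, Real.cos (u * X ω) ∂μ) ^ 2) := by
  set c := ∫ ω, Real.cos (u * X ω) ∂μ
  have hc := integrable_cos_mul (μ := μ) hX u
  have h : ∫ ω, (4 * c * Real.cos (u * X ω) - (2 * c ^ 2 + 1)) ∂μ ≤
      ∫ ω, Real.cos (2 * u * X ω) ∂μ := by
    refine integral_mono ((hc.const_mul _).sub (integrable_const _))
      (integrable_cos_mul hX (2 * u)) fun ω => ?_
    have : Real.cos (2 * u * X ω) = 2 * Real.cos (u * X ω) ^ 2 - 1 := by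
      rw [mul_assoc, Real.cos_two_mul]
    simp only [this]
    nlinarith [sq_nonneg (Real.cos (u * X ω) - c)]
  rw [integral_sub (hc.const_mul _) (integrable_const _), integral_const_mul] at h
  simp only [integral_const, probReal_univ, one_smul] at h
  change 4 * c * c - (2 * c ^ 2 + 1) ≤ _ at h
  nlinarith

theorem abs_integral_cos_le_one {Ω : Type*} [MeasurableSpace Ω] {μ : Measure Ω}
    [IsProbabilityMeasure μ] (X : Ω → ℝ) (u : ℝ) : |∫ ω, Real.cos (u * X ω) ∂μ| ≤ 1 := by
  simpa using norm_integral_le_of_norm_le_const (μ := μ) (f := fun ω => Real.cos (u * X ω))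
    (C := 1) (ae_of_all _ fun ω => Real.abs_cos_le_one _)

/-- For `|x| ≤ r` the argument `2x/r` lies in `[-π, π]`, where `cos y ≤ 1 - 2y²/π²`; the factor
`π²r²/8` normalizes the quadratic term to `x²`. -/
theorem min_one_sq_le {r : ℝ} (hr : 0 < r) (x : ℝ) :
    min 1 (x ^ 2) ≤ {x : ℝ | r < |x|}.indicator 1 x +
      Real.pi ^ 2 * r ^ 2 / 8 * (1 - Real.cos (2 * r⁻¹ * x)) := by
  have hcos : 0 ≤ Real.pi ^ 2 * r ^ 2 / 8 * (1 - Real.cos (2 * r⁻¹ * x)) :=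
    mul_nonneg (by positivity) (by linarith [Real.cos_le_one (2 * r⁻¹ * x)])
  by_cases hx : r < |x|
  · rw [Set.indicator_of_mem (by exact hx), Pi.one_apply]
    linarith [min_le_left 1 (x ^ 2)]
  · rw [Set.indicator_of_notMem (by exact hx), zero_add]
    refine (min_le_right _ _).trans ?_
    have h1 : |2 * r⁻¹ * x| ≤ Real.pi := by
      rw [abs_mul, abs_of_pos (by positivity : 0 < 2 * r⁻¹)]
      have : 2 * r⁻¹ * |x| ≤ 2 * r⁻¹ * r := by gcongr; exact not_lt.1 hx
      rw [mul_assoc 2 r⁻¹ r, inv_mul_cancel₀ hr.ne'] at this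
      linarith [Real.pi_gt_three]
    have h2 := Real.cos_le_one_sub_mul_cos_sq h1
    have h3 : Real.pi ^ 2 * r ^ 2 / 8 * (2 / Real.pi ^ 2 * (2 * r⁻¹ * x) ^ 2) = x ^ 2 := by
      field_simp
      norm_num
    rw [← h3]
    have : 0 ≤ Real.pi ^ 2 * r ^ 2 / 8 := by positivity
    nlinarith

theorem exists_forall_half_le_norm_charFun (ν : Measure ℝ) [IsProbabilityMeasure ν] :
    ∃ δ > 0, ∀ u : ℝ, |u| ≤ δ → 1 / 2 ≤ ‖charFun ν u‖ := by
  have hc : ContinuousAt (fun u => ‖charFun ν u‖) 0 := continuous_charFun.norm.continuousAt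
  have h0 : (1 / 2 : ℝ) < ‖charFun ν 0‖ := by
    rw [charFun_zero]
    norm_num
  obtain ⟨ε, hε, h⟩ := Metric.eventually_nhds_iff.1 (hc.eventually (lt_mem_nhds h0))
  exact ⟨ε / 2, by positivity, fun u hu => (h (by rw [Real.dist_eq, sub_zero]; linarith)).le⟩

/-- If a random variable splits off arbitrarily large finite sums of independent symmetric random
variables as independent summands, then the truncated second moments are summable. -/
theorem summable_integral_min_one_sq {ι Ω : Type*} [MeasurableSpace Ω] {μ : Measure Ω}
    [IsProbabilityMeasure μ] {V : ι → Ω → ℝ} (hV : ∀ k, Measurable (V k)) (hi : iIndepFun V μ)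
    (hs : ∀ k, IdentDistrib (V k) (fun ω => -V k ω) μ μ) {W : Ω → ℝ} (hW : AEMeasurable W μ)
    (hdec : ∀ F : Finset ι, ∃ G, F ⊆ G ∧ ∃ T : Ω → ℝ, Measurable T ∧
      IndepFun (fun ω => ∑ k ∈ G, V k ω) T μ ∧ W =ᵐ[μ] fun ω => ∑ k ∈ G, V k ω + T ω) :
    Summable fun k => ∫ ω, min 1 (V k ω ^ 2) ∂μ := by
  classical
  set c : ι → ℝ → ℝ := fun k u => ∫ ω, Real.cos (u * V k ω) ∂μ with hcdef
  have hc1 : ∀ k u, |c k u| ≤ 1 := fun k u => abs_integral_cos_le_one (V k) u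
  have hchar : ∀ k u, charFun (μ.map (V k)) u = (c k u : ℂ) := fun k u =>
    charFun_map_of_symmetric (hV k) (hs k) u
  have hprob : ∀ X : Ω → ℝ, AEMeasurable X μ → IsProbabilityMeasure (μ.map X) :=
    fun X hX => Measure.isProbabilityMeasure_map hX
  have := hprob W hW
  obtain ⟨δ, hδ, hδW⟩ := exists_forall_half_le_norm_charFun (μ.map W)
  -- The characteristic function of `W` factors over `G` and `T`. All factors have modulus at most
  -- `1`, so dropping `T` and the indices outside `F` only increases the product.
  have hprod : ∀ (F : Finset ι) (u : ℝ), |u| ≤ δ → 1 / 2 ≤ ∏ k ∈ F, |c k u| := by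
    intro F u hu
    obtain ⟨G, hFG, T, hT, hind, hWT⟩ := hdec F
    have := hprob T hT.aemeasurable
    have h1 := hδW u hu
    rw [Measure.map_congr hWT, hind.charFun_map_fun_add_eq_mul (by fun_prop) (by fun_prop),
      (hi.restrict G).charFun_map_fun_finsetSum_eq_prod (fun k _ => (hV k).aemeasurable),
      Pi.mul_apply, Finset.prod_apply, norm_mul, norm_prod] at h1
    simp only [hchar, Complex.norm_real, Real.norm_eq_abs] at h1
    have h2 : ∏ k ∈ G, |c k u| ≤ ∏ k ∈ F, |c k u| :=
      Finset.prod_le_prod_of_subset_of_le_one hFG (fun k _ => abs_nonneg _)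
        (fun k _ _ => hc1 k u)
    have h3 := norm_charFun_le_one (μ := μ.map T) u
    have h4 : 0 ≤ ∏ k ∈ G, |c k u| := Finset.prod_nonneg fun k _ => abs_nonneg _
    nlinarith
  -- From `1/4 ≤ ∏ c² ≤ exp (-∑ (1 - c²))` at `u / 2` one gets `∑ (1 - c²) ≤ log 4`. The doubling
  -- inequality carries this to `u`, which widens the admissible range from `δ` to `2δ`.
  obtain ⟨C, hC⟩ : ∃ C : ℝ, ∀ (F : Finset ι) (u : ℝ), |u| ≤ 2 * δ → ∑ k ∈ F, (1 - c k u) ≤ C := by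
    refine ⟨2 * Real.log 4, fun F u hu => ?_⟩
    have hu2 : |u / 2| ≤ δ := by rw [abs_div, abs_two]; linarith
    have h1 : ∏ k ∈ F, (c k (u / 2)) ^ 2 ≤ Real.exp (-∑ k ∈ F, (1 - (c k (u / 2)) ^ 2)) := by
      rw [← Finset.sum_neg_distrib, Real.exp_sum]
      refine Finset.prod_le_prod (fun k _ => sq_nonneg _) fun k _ => ?_
      have := Real.add_one_le_exp (-(1 - (c k (u / 2)) ^ 2))
      linarith
    have h2 : (1 / 4 : ℝ) ≤ ∏ k ∈ F, (c k (u / 2)) ^ 2 := by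
      have := hprod F (u / 2) hu2
      have h3 : ∏ k ∈ F, (c k (u / 2)) ^ 2 = (∏ k ∈ F, |c k (u / 2)|) ^ 2 := by
        rw [← Finset.prod_pow]
        simp
      rw [h3]
      nlinarith
    have h3 : Real.log (1 / 4) ≤ -∑ k ∈ F, (1 - (c k (u / 2)) ^ 2) := by
      rw [Real.log_le_iff_le_exp (by norm_num)]
      exact h2.trans h1
    rw [one_div, Real.log_inv] at h3
    calc ∑ k ∈ F, (1 - c k u) ≤ ∑ k ∈ F, 2 * (1 - (c k (u / 2)) ^ 2) := by
          refine Finset.sum_le_sum fun k _ => ?_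
          have := one_sub_integral_cos_two_mul_le (μ := μ) (hV k) (u / 2)
          rwa [mul_div_cancel₀ u two_ne_zero] at this
      _ = 2 * ∑ k ∈ F, (1 - (c k (u / 2)) ^ 2) := by rw [Finset.mul_sum]
      _ ≤ 2 * Real.log 4 := by linarith
  -- With this `r`, both the tail estimate, an average over `[-2/r, 2/r]`, and the cosine term at
  -- `2/r` only use arguments in the range `2δ` of `hC`.
  set r : ℝ := δ⁻¹ with hr
  have hr0 : 0 < r := inv_pos.2 hδ
  have hrδ : 2 * r⁻¹ = 2 * δ := by rw [hr, inv_inv]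
  have hcc : ∀ k, Continuous (c k) := fun k => by
    have := hprob (V k) (hV k).aemeasurable
    have h : c k = fun u => (charFun (μ.map (V k)) u).re := by
      funext u
      rw [hchar, Complex.ofReal_re]
    rw [h]
    exact Complex.continuous_re.comp continuous_charFun
  have hterm : ∀ k, ∫ ω, min 1 (V k ω ^ 2) ∂μ ≤
      2⁻¹ * r * (∫ u in (-2 * r⁻¹)..(2 * r⁻¹), (1 - c k u)) +
        Real.pi ^ 2 * r ^ 2 / 8 * (1 - c k (2 * r⁻¹)) := by
    intro k
    have := hprob (V k) (hV k).aemeasurable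
    have hms : MeasurableSet {x : ℝ | r < |x|} := measurableSet_lt measurable_const (by fun_prop)
    have hI1 : Integrable (fun ω => {x : ℝ | r < |x|}.indicator (1 : ℝ → ℝ) (V k ω)) μ :=
      Integrable.of_bound ((measurable_one.indicator hms).comp (hV k)).aestronglyMeasurable 1
        (ae_of_all _ fun ω => by
          by_cases h : V k ω ∈ {x : ℝ | r < |x|}
          · simp [Set.indicator_of_mem h]
          · simp [Set.indicator_of_notMem h])
    have hI2 : Integrable (fun ω => Real.pi ^ 2 * r ^ 2 / 8 *
        (1 - Real.cos (2 * r⁻¹ * V k ω))) μ :=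
      ((integrable_const _).sub (integrable_cos_mul (hV k) _)).const_mul _
    have h1 : ∫ ω, min 1 (V k ω ^ 2) ∂μ ≤ ∫ ω, ({x : ℝ | r < |x|}.indicator (1 : ℝ → ℝ) (V k ω) +
        Real.pi ^ 2 * r ^ 2 / 8 * (1 - Real.cos (2 * r⁻¹ * V k ω))) ∂μ := by
      refine integral_mono ?_ (hI1.add hI2) fun ω => min_one_sq_le hr0 _
      exact Integrable.of_bound (by fun_prop) 1 (ae_of_all _ fun ω => by
        rw [Real.norm_eq_abs, abs_of_nonneg (le_min zero_le_one (sq_nonneg _))]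
        exact min_le_left _ _)
    rw [integral_add hI1 hI2, integral_const_mul,
      integral_sub (integrable_const _) (integrable_cos_mul (hV k) _)] at h1
    simp only [integral_const, probReal_univ, one_smul] at h1
    refine h1.trans (add_le_add ?_ le_rfl)
    have h2 := measureReal_abs_gt_le_integral_charFun (μ := μ.map (V k)) hr0
    have h3 : ∫ ω, {x : ℝ | r < |x|}.indicator (1 : ℝ → ℝ) (V k ω) ∂μ =
        (μ.map (V k)).real {x | r < |x|} := by
      rw [← integral_indicator_one hms, integral_map (hV k).aemeasurable
        (measurable_one.indicator hms).aestronglyMeasurable]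
    rw [h3]
    refine h2.trans (le_of_eq ?_)
    congr 1
    have h4 : ∀ u : ℝ, 1 - charFun (μ.map (V k)) u = ((1 - c k u : ℝ) : ℂ) := fun u => by
      rw [hchar]
      push_cast
      rfl
    simp only [h4]
    rw [intervalIntegral.integral_ofReal, Complex.norm_real, Real.norm_eq_abs, abs_of_nonneg]
    refine intervalIntegral.integral_nonneg ?_ fun u _ => ?_
    · have : 0 < r⁻¹ := inv_pos.2 hr0
      linarith
    · linarith [le_abs_self (c k u), hc1 k u]
  refine summable_of_sum_le (c := 2⁻¹ * r * (∫ u in (-2 * r⁻¹)..(2 * r⁻¹), C) +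
      Real.pi ^ 2 * r ^ 2 / 8 * C)
    (fun k => integral_nonneg fun ω => le_min zero_le_one (sq_nonneg _)) fun F => ?_
  refine (Finset.sum_le_sum fun k _ => hterm k).trans ?_
  have hint : ∀ k ∈ F, IntervalIntegrable (fun u => 1 - c k u) volume (-2 * r⁻¹) (2 * r⁻¹) :=
    fun k _ => (continuous_const.sub (hcc k)).intervalIntegrable _ _
  rw [Finset.sum_add_distrib, ← Finset.mul_sum, ← Finset.mul_sum,
    ← intervalIntegral.integral_finsetSum hint]
  refine add_le_add (mul_le_mul_of_nonneg_left ?_ (by positivity))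
    (mul_le_mul_of_nonneg_left ?_ (by positivity))
  · refine intervalIntegral.integral_mono_on ?_ ?_ ?_ fun u hu => hC F u ?_
    · have : 0 < r⁻¹ := inv_pos.2 hr0
      linarith
    · exact (continuous_finsetSum _ fun k _ =>
        continuous_const.sub (hcc k)).intervalIntegrable _ _
    · exact continuous_const.intervalIntegrable _ _
    · rw [← hrδ, abs_le]
      exact ⟨by linarith [hu.1], hu.2⟩
  · refine hC F _ ?_
    rw [← hrδ, abs_of_pos]
    have : 0 < r⁻¹ := inv_pos.2 hr0
    linarith

/-! ### Sign changes and Lévy's maximal inequality over boxes. -/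

theorem measurable_rectPartialSum {d : ℕ} (N : Fin d → ℕ) :
    Measurable fun x : (Fin d → ℕ) → ℂ => rectPartialSum x N := by
  unfold rectPartialSum
  fun_prop

open scoped Classical in
/-- Change the sign of the members of a family with index in `C`. -/
noncomputable def flipSign {ι : Type*} (C : Set ι) (x : ι → ℂ) : ι → ℂ :=
  fun k => if k ∈ C then -x k else x k

theorem measurable_flipSign {ι : Type*} (C : Set ι) : Measurable (flipSign C) := by
  classical
  refine measurable_pi_iff.2 fun k => ?_
  unfold flipSign
  split_ifs <;> fun_prop

/-- The law of a family of independent symmetric random variables is invariant under changes of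
sign. -/
theorem measurePreserving_flipSign {ι Ω : Type*} [Countable ι] [MeasurableSpace Ω]
    {μ : Measure Ω} {A : ι → Ω → ℂ} (hA : ∀ k, Measurable (A k))
    (hi : iIndepFun A μ) (hs : ∀ k, IdentDistrib (A k) (fun ω => -A k ω) μ μ) (C : Set ι) :
    MeasurePreserving (flipSign C) (μ.map fun ω k => A k ω) (μ.map fun ω k => A k ω) := by
  classical
  refine ⟨measurable_flipSign C, ?_⟩
  rw [Measure.map_map (measurable_flipSign C) (measurable_pi_iff.2 hA)]
  have hi' : iIndepFun (fun k ω => if k ∈ C then -A k ω else A k ω) μ :=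
    hi.comp (fun k z => if k ∈ C then -z else z) fun k => by split_ifs <;> fun_prop
  have h : ∀ k, IdentDistrib (A k) (fun ω => if k ∈ C then -A k ω else A k ω) μ μ := fun k => by
    by_cases hk : k ∈ C
    · simpa only [if_pos hk] using hs k
    · simpa only [if_neg hk] using IdentDistrib.refl (hA k).aemeasurable
  exact (IdentDistrib.pi h hi hi').map_eq.symm

/-- The reflection principle: every point of `F n` or its image under `σ n` lies in `G`, and `σ n`
preserves both `F n` and the measure, so at least half of `F n` lies in `G`. Disjointness allows
summation over `n`. -/
theorem measure_biUnion_le_two_mul {𝒳 : Type*} [MeasurableSpace 𝒳] {ν : Measure 𝒳}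
    {s : Finset ℕ} {F : ℕ → Set 𝒳} {G : Set 𝒳} {σ : ℕ → 𝒳 → 𝒳}
    (hσ : ∀ n, MeasurePreserving (σ n) ν ν) (hF : ∀ n, MeasurableSet (F n))
    (hG : MeasurableSet G) (hd : Pairwise (Function.onFun Disjoint F))
    (hinv : ∀ n, σ n ⁻¹' F n = F n) (hsub : ∀ n, F n ⊆ G ∪ σ n ⁻¹' G) :
    ν (⋃ n ∈ s, F n) ≤ 2 * ν G := by
  have h1 : ∀ n, ν (F n) ≤ 2 * ν (F n ∩ G) := fun n => by
    calc ν (F n) ≤ ν ((F n ∩ G) ∪ σ n ⁻¹' (F n ∩ G)) := by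
          refine measure_mono fun x hx => ?_
          rcases hsub n hx with h | h
          · exact Or.inl ⟨hx, h⟩
          · have h' : x ∈ σ n ⁻¹' F n := by rwa [hinv n]
            exact Or.inr ⟨h', h⟩
      _ ≤ ν (F n ∩ G) + ν (σ n ⁻¹' (F n ∩ G)) := measure_union_le _ _
      _ = 2 * ν (F n ∩ G) := by
          rw [(hσ n).measure_preimage ((hF n).inter hG).nullMeasurableSet, two_mul]
  calc ν (⋃ n ∈ s, F n) ≤ ∑ n ∈ s, ν (F n) := measure_biUnion_finset_le s F
    _ ≤ ∑ n ∈ s, 2 * ν (F n ∩ G) := Finset.sum_le_sum fun n _ => h1 n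
    _ = 2 * ν (⋃ n ∈ s, F n ∩ G) := by
        rw [← Finset.mul_sum, measure_biUnion_finset
          (fun i _ j _ hij => (hd hij).mono Set.inter_subset_left Set.inter_subset_left)
          fun n _ => (hF n).inter hG]
    _ ≤ 2 * ν G := by
        gcongr
        exact Set.iUnion₂_subset fun n _ => Set.inter_subset_right

open scoped Classical in
/-- The multi-index with the coordinates of `N` on `I` and those of `M` elsewhere. -/
noncomputable def mixIndex {d : ℕ} (I : Finset (Fin d)) (M N : Fin d → ℕ) : Fin d → ℕ :=
  fun i => if i ∈ I then N i else M i

open scoped Classical in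
/-- Set a family to `0` at the indices whose `i`-th coordinate exceeds `n`. -/
noncomputable def cutCoord {d : ℕ} (i : Fin d) (n : ℕ) (x : (Fin d → ℕ) → ℂ) : (Fin d → ℕ) → ℂ :=
  fun k => if k i ≤ n then x k else 0

theorem measurable_cutCoord {d : ℕ} (i : Fin d) (n : ℕ) : Measurable (cutCoord i n) := by
  classical
  refine measurable_pi_iff.2 fun k => ?_
  unfold cutCoord
  split_ifs <;> fun_prop

/-- Flips beyond level `n` are invisible to truncations at levels up to `n`; this makes the
first-passage events invariant under reflection. -/
theorem cutCoord_flipSign {d : ℕ} (i : Fin d) {m n : ℕ} (h : m ≤ n) (x : (Fin d → ℕ) → ℂ) :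
    cutCoord i m (flipSign {k | n < k i} x) = cutCoord i m x := by
  funext k
  by_cases hk : k i ≤ m
  · have : ¬ n < k i := not_lt.2 (hk.trans h)
    simp [cutCoord, flipSign, hk, this]
  · simp [cutCoord, hk]

/-- The truncated sum is the mean of the full and the reflected sum, so one of these is at least as
large in norm. -/
theorem two_mul_rectPartialSum_cutCoord {d : ℕ} (i : Fin d) (n : ℕ) (x : (Fin d → ℕ) → ℂ)
    (K : Fin d → ℕ) : 2 * rectPartialSum (cutCoord i n x) K =
      rectPartialSum x K + rectPartialSum (flipSign {k | n < k i} x) K := by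
  simp only [rectPartialSum, Finset.mul_sum, ← Finset.sum_add_distrib]
  refine Finset.sum_congr rfl fun k _ => ?_
  by_cases hk : k i ≤ n
  · simp [cutCoord, flipSign, hk, two_mul]
  · simp [cutCoord, flipSign, hk, not_le.1 hk]

theorem rectPartialSum_cutCoord {d : ℕ} {i : Fin d} {I : Finset (Fin d)} (hi : i ∉ I)
    {M N : Fin d → ℕ} (hN : N ≤ M) (x : (Fin d → ℕ) → ℂ) :
    rectPartialSum (cutCoord i (N i) x) (mixIndex I M N) =
      rectPartialSum x (mixIndex (insert i I) M N) := by
  classical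
  unfold rectPartialSum cutCoord
  rw [← Finset.sum_filter]
  refine Finset.sum_congr ?_ fun _ _ => rfl
  ext k
  simp only [Finset.mem_filter, Finset.mem_Iic, Pi.le_def, mixIndex, Finset.mem_insert]
  constructor
  · rintro ⟨h1, h2⟩ j
    by_cases hj : j = i
    · subst hj
      simpa using h2
    · simpa [hj] using h1 j
  · intro h
    refine ⟨fun j => ?_, by simpa using h i⟩
    by_cases hj : j = i
    · subst hj
      have h1 := h j
      have h2 : N j ≤ M j := hN j
      simp only [true_or, if_true] at h1
      simpa [hi] using h1.trans h2
    · simpa [hj] using h j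

/-- Lévy's maximal inequality for multi-indexed partial sums, with respect to the law of a family
that is invariant under changes of sign. -/
theorem levy_mixIndex {d : ℕ} {ν : Measure ((Fin d → ℕ) → ℂ)}
    (hν : ∀ C, MeasurePreserving (flipSign C) ν ν) (M : Fin d → ℕ) (a : ℝ)
    (I : Finset (Fin d)) :
    ν {x | ∃ N ≤ M, a < ‖rectPartialSum x (mixIndex I M N)‖} ≤
      2 ^ I.card * ν {x | a < ‖rectPartialSum x M‖} := by
  classical
  -- The coordinates over which the maximum is taken are released one at a time, each by a
  -- one-parameter reflection costing a factor `2`.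
  induction I using Finset.induction_on with
  | empty =>
    refine le_of_eq ?_
    have h : ∀ N, mixIndex ∅ M N = M := fun N => by
      funext i
      simp [mixIndex]
    simp only [h, Finset.card_empty, pow_zero, one_mul]
    congr 1
    ext x
    exact ⟨fun ⟨_, _, h⟩ => h, fun h => ⟨M, le_rfl, h⟩⟩
  | insert i I hi ih =>
    set G : Set ((Fin d → ℕ) → ℂ) := {x | ∃ N ≤ M, a < ‖rectPartialSum x (mixIndex I M N)‖} with hG
    have hGm : MeasurableSet G := by
      have : G = ⋃ N, ⋃ (_ : N ≤ M), {x | a < ‖rectPartialSum x (mixIndex I M N)‖} := by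
        ext x
        simp [hG]
      rw [this]
      exact MeasurableSet.iUnion fun N => MeasurableSet.iUnion fun _ =>
        measurableSet_lt measurable_const (measurable_rectPartialSum _).norm
    -- `F n` says that `n` is the first truncation level in coordinate `i` at which the event `G`
    -- occurs.
    set F : ℕ → Set ((Fin d → ℕ) → ℂ) := fun n =>
      cutCoord i n ⁻¹' G ∩ ⋂ m ∈ Set.Iio n, (cutCoord i m ⁻¹' G)ᶜ with hF
    have hFm : ∀ n, MeasurableSet (F n) := fun n =>
      (measurable_cutCoord i n hGm).inter
        (MeasurableSet.biInter (Set.to_countable _) fun m _ => (measurable_cutCoord i m hGm).compl)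
    have hsub : {x | ∃ N ≤ M, a < ‖rectPartialSum x (mixIndex (insert i I) M N)‖} ⊆
        ⋃ n ∈ Finset.range (M i + 1), F n := by
      rintro x ⟨N, hN, hx⟩
      have hex : ∃ n, cutCoord i n x ∈ G := ⟨N i, N, hN, by rwa [rectPartialSum_cutCoord hi hN]⟩
      have hle : Nat.find hex ≤ N i :=
        Nat.find_min' hex ⟨N, hN, by rwa [rectPartialSum_cutCoord hi hN]⟩
      refine Set.mem_biUnion (x := Nat.find hex) ?_ ⟨Nat.find_spec hex, ?_⟩
      · have : N i ≤ M i := hN i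
        simp only [Finset.coe_range, Set.mem_Iio]
        omega
      · exact Set.mem_iInter₂.2 fun m hm => Nat.find_min hex hm
    have key := measure_biUnion_le_two_mul (ν := ν) (s := Finset.range (M i + 1)) (F := F) (G := G)
      (σ := fun n => flipSign {k | n < k i}) (fun n => hν _) hFm hGm ?_ ?_ ?_
    · calc _ ≤ ν (⋃ n ∈ Finset.range (M i + 1), F n) := measure_mono hsub
        _ ≤ 2 * ν G := key
        _ ≤ 2 * (2 ^ I.card * ν {x | a < ‖rectPartialSum x M‖}) := by gcongr
        _ = _ := by rw [Finset.card_insert_of_notMem hi, pow_succ']; ring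
    · intro m n hmn
      refine Set.disjoint_left.2 fun x hm hn => ?_
      rcases lt_or_gt_of_ne hmn with h | h
      · exact Set.mem_iInter₂.1 hn.2 m h hm.1
      · exact Set.mem_iInter₂.1 hm.2 n h hn.1
    · intro n
      ext x
      simp only [hF, Set.mem_preimage, Set.mem_inter_iff, Set.mem_iInter, Set.mem_compl_iff,
        Set.mem_Iio, cutCoord_flipSign i le_rfl]
      refine and_congr_right fun _ => forall₂_congr fun m hm => ?_
      rw [cutCoord_flipSign i hm.le]
    · rintro n x ⟨⟨N, hN, hx⟩, -⟩
      by_contra hcon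
      simp only [Set.mem_union, Set.mem_preimage, not_or] at hcon
      have h1 : ‖rectPartialSum x (mixIndex I M N)‖ ≤ a :=
        not_lt.1 fun h => hcon.1 ⟨N, hN, h⟩
      have h2 : ‖rectPartialSum (flipSign {k | n < k i} x) (mixIndex I M N)‖ ≤ a :=
        not_lt.1 fun h => hcon.2 ⟨N, hN, h⟩
      have h3 := norm_add_le (rectPartialSum x (mixIndex I M N))
        (rectPartialSum (flipSign {k | n < k i} x) (mixIndex I M N))
      rw [← two_mul_rectPartialSum_cutCoord, norm_mul, Complex.norm_two] at h3
      linarith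

theorem levy_rectPartialSum {d : ℕ} {Ω : Type*} [MeasurableSpace Ω]
    {μ : Measure Ω} {A : (Fin d → ℕ) → Ω → ℂ} (hA : ∀ k, Measurable (A k))
    (hi : iIndepFun A μ) (hs : ∀ k, IdentDistrib (A k) (fun ω => -A k ω) μ μ)
    (M : Fin d → ℕ) (a : ℝ) :
    μ {ω | ∃ N ≤ M, a < ‖rectPartialSum (fun k => A k ω) N‖} ≤
      2 ^ d * μ {ω | a < ‖rectPartialSum (fun k => A k ω) M‖} := by
  have h := levy_mixIndex (measurePreserving_flipSign hA hi hs) M a Finset.univ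
  have hmix : ∀ N, mixIndex Finset.univ M N = N := fun N => by
    funext i
    simp [mixIndex]
  simp only [hmix, Finset.card_univ, Fintype.card_fin] at h
  have hm : Measurable fun ω k => A k ω := measurable_pi_iff.2 hA
  have hlt : ∀ N : Fin d → ℕ, MeasurableSet {x : (Fin d → ℕ) → ℂ | a < ‖rectPartialSum x N‖} :=
    fun N => measurableSet_lt measurable_const (measurable_rectPartialSum _).norm
  have hex : MeasurableSet {x : (Fin d → ℕ) → ℂ | ∃ N ≤ M, a < ‖rectPartialSum x N‖} := by
    have : {x : (Fin d → ℕ) → ℂ | ∃ N ≤ M, a < ‖rectPartialSum x N‖} =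
        ⋃ N, ⋃ (_ : N ≤ M), {x | a < ‖rectPartialSum x N‖} := by
      ext x
      simp
    rw [this]
    exact MeasurableSet.iUnion fun N => MeasurableSet.iUnion fun _ => hlt N
  rw [Measure.map_apply hm hex, Measure.map_apply hm (hlt M)] at h
  exact h

/-! ### Almost sure convergence of series of independent symmetric terms. -/

theorem tendsto_finset_Iic_atTop (d : ℕ) :
    Tendsto (fun N : Fin d → ℕ => Finset.Iic N) atTop atTop := by
  refine tendsto_atTop.2 fun F => ?_
  filter_upwards [eventually_ge_atTop (F.sup id)] with N hN k hk
  exact Finset.mem_Iic.2 ((Finset.le_sup (f := id) hk).trans hN)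

theorem hasRectSum_of_hasSum {d : ℕ} {x : (Fin d → ℕ) → ℂ} {l : ℂ} (h : HasSum x l) :
    HasRectSum x l := by
  have h' : Tendsto (fun s : Finset (Fin d → ℕ) => ∑ k ∈ s, x k) atTop (𝓝 l) := h
  exact h'.comp (tendsto_finset_Iic_atTop d)

theorem HasRectSum.add {d : ℕ} {x y : (Fin d → ℕ) → ℂ} {l m : ℂ} (hx : HasRectSum x l)
    (hy : HasRectSum y m) : HasRectSum (fun k => x k + y k) (l + m) := by
  refine (Tendsto.add hx hy).congr fun N => ?_
  simp only [rectPartialSum, Finset.sum_add_distrib]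

theorem integral_eq_zero_of_symmetric {Ω : Type*} [MeasurableSpace Ω] {μ : Measure Ω}
    {X : Ω → ℝ} (hs : IdentDistrib X (fun ω => -X ω) μ μ) : ∫ ω, X ω ∂μ = 0 := by
  have := hs.integral_eq
  rw [integral_neg] at this
  linarith

theorem integral_sq_sum {ι Ω : Type*} [MeasurableSpace Ω] {μ : Measure Ω} [IsProbabilityMeasure μ]
    {V : ι → Ω → ℝ} (hV : ∀ k, Measurable (V k)) (hb : ∀ k ω, |V k ω| ≤ 1) (hi : iIndepFun V μ)
    (hs : ∀ k, IdentDistrib (V k) (fun ω => -V k ω) μ μ) (F : Finset ι) :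
    ∫ ω, (∑ k ∈ F, V k ω) ^ 2 ∂μ = ∑ k ∈ F, ∫ ω, V k ω ^ 2 ∂μ := by
  have hL : ∀ k, MemLp (V k) 2 μ := fun k =>
    MemLp.of_bound (hV k).aestronglyMeasurable 1 (ae_of_all _ (hb k))
  have h0 : ∀ k, ∫ ω, V k ω ∂μ = 0 := fun k => integral_eq_zero_of_symmetric (hs k)
  have h := IndepFun.variance_sum (X := V) (s := F) (fun k _ => hL k)
    fun i _ j _ hij => hi.indepFun hij
  have h1 : ∫ ω, (∑ k ∈ F, V k) ω ∂μ = 0 := by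
    simp only [Finset.sum_apply]
    rw [integral_finsetSum _ fun k _ => (hL k).integrable (by norm_num)]
    simp [h0]
  rw [variance_of_integral_eq_zero (Finset.aemeasurable_sum _ fun k _ => (hV k).aemeasurable) h1]
    at h
  simp only [Finset.sum_apply] at h
  rw [h]
  exact Finset.sum_congr rfl fun k _ => variance_of_integral_eq_zero (hV k).aemeasurable (h0 k)

/-- Real and imaginary parts are treated separately, each family being independent over `k` and
centred by symmetry. No independence between the two parts is needed. -/
theorem integral_norm_sq_sum {ι Ω : Type*} [MeasurableSpace Ω] {μ : Measure Ω}
    [IsProbabilityMeasure μ]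
    {A : ι → Ω → ℂ} (hA : ∀ k, Measurable (A k)) (hb : ∀ k ω, ‖A k ω‖ ≤ 1) (hi : iIndepFun A μ)
    (hs : ∀ k, IdentDistrib (A k) (fun ω => -A k ω) μ μ) (F : Finset ι) :
    ∫ ω, ‖∑ k ∈ F, A k ω‖ ^ 2 ∂μ = ∑ k ∈ F, ∫ ω, ‖A k ω‖ ^ 2 ∂μ := by
  have hre : ∀ k ω, |(A k ω).re| ≤ 1 := fun k ω => (Complex.abs_re_le_norm _).trans (hb k ω)
  have him : ∀ k ω, |(A k ω).im| ≤ 1 := fun k ω => (Complex.abs_im_le_norm _).trans (hb k ω)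
  have h1 := integral_sq_sum (μ := μ) (V := fun k ω => (A k ω).re) (fun k => by fun_prop) hre
    (hi.comp (fun _ => Complex.re) fun _ => Complex.measurable_re)
    (fun k => (hs k).comp Complex.measurable_re) F
  have h2 := integral_sq_sum (μ := μ) (V := fun k ω => (A k ω).im) (fun k => by fun_prop) him
    (hi.comp (fun _ => Complex.im) fun _ => Complex.measurable_im)
    (fun k => (hs k).comp Complex.measurable_im) F
  have hn : ∀ z : ℂ, ‖z‖ ^ 2 = z.re ^ 2 + z.im ^ 2 := fun z => by
    rw [← Complex.normSq_eq_norm_sq, Complex.normSq_apply]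
    ring
  have hb1 : ∀ V : ι → Ω → ℝ, (∀ k, Measurable (V k)) → (∀ k ω, |V k ω| ≤ 1) →
      ∀ F : Finset ι, Integrable (fun ω => (∑ k ∈ F, V k ω) ^ 2) μ := fun V hV hVb F =>
    (MemLp.of_bound (p := 2) (Finset.measurable_fun_sum _ fun k _ => hV k).aestronglyMeasurable
      (F.card : ℝ) (ae_of_all _ fun ω => (norm_sum_le _ _).trans (by
        simpa using Finset.sum_le_sum fun k (_ : k ∈ F) => hVb k ω))).integrable_sq
  have hb2 : ∀ V : Ω → ℝ, Measurable V → (∀ ω, |V ω| ≤ 1) →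
      Integrable (fun ω => V ω ^ 2) μ := fun V hV hVb =>
    (MemLp.of_bound (p := 2) hV.aestronglyMeasurable 1 (ae_of_all _ hVb)).integrable_sq
  simp only [hn, Complex.re_sum, Complex.im_sum]
  rw [integral_add (hb1 (fun k ω => (A k ω).re) (fun k => by fun_prop) hre F)
    (hb1 (fun k ω => (A k ω).im) (fun k => by fun_prop) him F), h1, h2, ← Finset.sum_add_distrib]
  refine Finset.sum_congr rfl fun k _ => ?_
  rw [integral_add (hb2 (fun ω => (A k ω).re) (by fun_prop) (hre k))
    (hb2 (fun ω => (A k ω).im) (by fun_prop) (him k))]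

/-- A Kolmogorov type maximal inequality for multi-indexed partial sums. -/
theorem measure_exists_lt_norm_rectPartialSum_le {d : ℕ} {Ω : Type*} [MeasurableSpace Ω]
    {μ : Measure Ω} [IsProbabilityMeasure μ] {A : (Fin d → ℕ) → Ω → ℂ}
    (hA : ∀ k, Measurable (A k)) (hb : ∀ k ω, ‖A k ω‖ ≤ 1)
    (hi : iIndepFun A μ) (hs : ∀ k, IdentDistrib (A k) (fun ω => -A k ω) μ μ)
    {ε : ℝ} (hε : 0 < ε) {c : ℝ} (hc : ∀ F : Finset (Fin d → ℕ),
      ∑ k ∈ F, ∫ ω, ‖A k ω‖ ^ 2 ∂μ ≤ c) :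
    μ {ω | ∃ N, ε < ‖rectPartialSum (fun k => A k ω) N‖} ≤
      2 ^ d * ENNReal.ofReal (c / ε ^ 2) := by
  have h1 : ∀ M : Fin d → ℕ, μ {ω | ∃ N ≤ M, ε < ‖rectPartialSum (fun k => A k ω) N‖} ≤
      2 ^ d * ENNReal.ofReal (c / ε ^ 2) := fun M => by
    refine (levy_rectPartialSum hA hi hs M ε).trans ?_
    gcongr
    have hm : Measurable fun ω => rectPartialSum (fun k => A k ω) M :=
      (measurable_rectPartialSum M).comp (measurable_pi_iff.2 hA)
    have hint : Integrable (fun ω => ‖rectPartialSum (fun k => A k ω) M‖ ^ 2) μ :=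
      (MemLp.of_bound (p := 2) hm.norm.aestronglyMeasurable ((Finset.Iic M).card : ℝ)
        (ae_of_all _ fun ω => by
          rw [norm_norm]
          exact (norm_sum_le _ _).trans (by
            simpa using Finset.sum_le_sum fun k (_ : k ∈ Finset.Iic M) => hb k ω))).integrable_sq
    have h2 := mul_meas_ge_le_integral_of_nonneg (ae_of_all _ fun ω => sq_nonneg _) hint (ε ^ 2)
    have h3 : ∫ ω, ‖rectPartialSum (fun k => A k ω) M‖ ^ 2 ∂μ ≤ c := by
      unfold rectPartialSum
      rw [integral_norm_sq_sum hA hb hi hs]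
      exact hc _
    have h4 : μ.real {ω | ε ^ 2 ≤ ‖rectPartialSum (fun k => A k ω) M‖ ^ 2} ≤ c / ε ^ 2 := by
      rw [le_div_iff₀ (by positivity), mul_comm]
      exact h2.trans h3
    calc μ {ω | ε < ‖rectPartialSum (fun k => A k ω) M‖}
        ≤ μ {ω | ε ^ 2 ≤ ‖rectPartialSum (fun k => A k ω) M‖ ^ 2} :=
          measure_mono fun ω hω => by
            have hω' : ε < ‖rectPartialSum (fun k => A k ω) M‖ := hω
            change ε ^ 2 ≤ ‖rectPartialSum (fun k => A k ω) M‖ ^ 2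
            gcongr
      _ = ENNReal.ofReal (μ.real {ω | ε ^ 2 ≤ ‖rectPartialSum (fun k => A k ω) M‖ ^ 2}) := by
          rw [ofReal_measureReal]
      _ ≤ _ := ENNReal.ofReal_le_ofReal h4
  have h2 : {ω | ∃ N, ε < ‖rectPartialSum (fun k => A k ω) N‖} =
      ⋃ n : ℕ, {ω | ∃ N ≤ (fun _ => n : Fin d → ℕ), ε < ‖rectPartialSum (fun k => A k ω) N‖} := by
    ext ω
    simp only [Set.mem_ofPred_eq, Set.mem_iUnion]
    constructor
    · rintro ⟨N, hN⟩
      exact ⟨Finset.univ.sup N, N, fun i => Finset.le_sup (Finset.mem_univ i), hN⟩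
    · rintro ⟨_, N, _, hN⟩
      exact ⟨N, hN⟩
  rw [h2, Monotone.measure_iUnion]
  · exact iSup_le fun n => h1 _
  · rintro m n hmn ω ⟨N, hN, h⟩
    exact ⟨N, hN.trans fun _ => hmn, h⟩

/-- Almost sure Cauchy property: for `N ≥ m` the difference of the partial sums at `N` and `m` is a
partial sum of the family with its terms `k ≤ m` deleted. The maximal inequality bounds all of these
at once by a tail of the variance series. -/
theorem ae_exists_hasRectSum_of_bounded {d : ℕ} {Ω : Type*} [MeasurableSpace Ω]
    {μ : Measure Ω} [IsProbabilityMeasure μ] {A : (Fin d → ℕ) → Ω → ℂ}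
    (hA : ∀ k, Measurable (A k)) (hb : ∀ k ω, ‖A k ω‖ ≤ 1)
    (hi : iIndepFun A μ) (hs : ∀ k, IdentDistrib (A k) (fun ω => -A k ω) μ μ)
    (hsum : Summable fun k => ∫ ω, ‖A k ω‖ ^ 2 ∂μ) : ConvergesRectAS μ A := by
  classical
  have hnn : ∀ k, 0 ≤ ∫ ω, ‖A k ω‖ ^ 2 ∂μ := fun k => integral_nonneg fun ω => sq_nonneg _
  have hcauchy : ∀ ε : ℝ, 0 < ε → ∀ᵐ ω ∂μ, ∃ m, ∀ N, m ≤ N →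
      ‖rectPartialSum (fun k => A k ω) N - rectPartialSum (fun k => A k ω) m‖ ≤ ε := by
    intro ε hε
    rw [ae_iff]
    have hbound : ∀ m : Fin d → ℕ, μ {ω | ¬ ∃ m, ∀ N, m ≤ N →
        ‖rectPartialSum (fun k => A k ω) N - rectPartialSum (fun k => A k ω) m‖ ≤ ε} ≤
        2 ^ d * ENNReal.ofReal ((∑' k : {k // k ∉ Finset.Iic m}, ∫ ω, ‖A k ω‖ ^ 2 ∂μ) /
          ε ^ 2) := by
      intro m
      -- Replacing the terms in the box by `0` keeps independence, symmetry and the bound.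
      set A' : (Fin d → ℕ) → Ω → ℂ := fun k ω => if k ∈ Finset.Iic m then 0 else A k ω with hA'
      have hg : ∀ k, Measurable (fun z : ℂ => if k ∈ Finset.Iic m then 0 else z) := fun k => by
        split_ifs <;> fun_prop
      refine (measure_mono ?_).trans (measure_exists_lt_norm_rectPartialSum_le (A := A')
        (fun k => (hg k).comp (hA k)) (fun k ω => ?_)
        (hi.comp (fun k z => if k ∈ Finset.Iic m then 0 else z) hg) (fun k => ?_) hε fun F => ?_)
      · intro ω hω
        simp only [Set.mem_ofPred_eq, not_exists, not_forall, not_le] at hω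
        obtain ⟨N, hmN, hN⟩ := hω m
        refine ⟨N, ?_⟩
        have h1 : rectPartialSum (fun k => A' k ω) N =
            rectPartialSum (fun k => A k ω) N - rectPartialSum (fun k => A k ω) m := by
          simp only [rectPartialSum, hA']
          rw [← Finset.sum_sdiff (Finset.Iic_subset_Iic.2 hmN) (f := fun k => A k ω),
            add_sub_cancel_right, ← Finset.sum_sdiff (Finset.Iic_subset_Iic.2 hmN),
            Finset.sum_congr rfl fun k hk => if_neg (Finset.mem_sdiff.1 hk).2,
            Finset.sum_congr rfl fun k hk => if_pos hk, Finset.sum_const_zero, add_zero]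
        rwa [h1]
      · simp only [hA']
        split_ifs
        · simp
        · exact hb k ω
      · by_cases hk : k ∈ Finset.Iic m
        · simpa only [hA', if_pos hk, neg_zero] using
            IdentDistrib.refl (μ := μ) (f := fun _ => (0 : ℂ)) aemeasurable_const
        · simpa only [hA', if_neg hk] using hs k
      · have h1 : ∑ k ∈ F, ∫ ω, ‖A' k ω‖ ^ 2 ∂μ =
            ∑ k ∈ F.subtype (· ∉ Finset.Iic m), ∫ ω, ‖A k ω‖ ^ 2 ∂μ := by
          rw [Finset.sum_subtype_eq_sum_filter (f := fun k => ∫ ω, ‖A k ω‖ ^ 2 ∂μ),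
            Finset.sum_filter]
          refine Finset.sum_congr rfl fun k _ => ?_
          by_cases hk : k ∈ Finset.Iic m
          · rw [if_neg (not_not.2 hk)]
            simp only [hA', if_pos hk, norm_zero]
            simp
          · simp only [hA', if_neg hk, if_pos hk]
        rw [h1]
        exact (hsum.subtype _).sum_le_tsum _ fun k _ => hnn k
    have hlim : Tendsto (fun m : Fin d → ℕ => 2 ^ d * ENNReal.ofReal
        ((∑' k : {k // k ∉ Finset.Iic m}, ∫ ω, ‖A k ω‖ ^ 2 ∂μ) / ε ^ 2)) atTop (𝓝 0) := by
      have h1 := (tendsto_tsum_compl_atTop_zero fun k => ∫ ω, ‖A k ω‖ ^ 2 ∂μ).comp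
        (tendsto_finset_Iic_atTop d)
      have h2 := ENNReal.tendsto_ofReal (h1.div_const (ε ^ 2))
      rw [zero_div, ENNReal.ofReal_zero] at h2
      have h3 := ENNReal.Tendsto.const_mul (a := 2 ^ d) h2 (Or.inr (by finiteness))
      rwa [mul_zero] at h3
    exact le_antisymm (ge_of_tendsto' hlim hbound) zero_le
  have hall : ∀ᵐ ω ∂μ, ∀ n : ℕ, ∃ m, ∀ N, m ≤ N →
      ‖rectPartialSum (fun k => A k ω) N - rectPartialSum (fun k => A k ω) m‖ ≤ 1 / ((n : ℝ) + 1) :=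
    ae_all_iff.2 fun n => hcauchy _ (by positivity)
  filter_upwards [hall] with ω hω
  refine cauchySeq_tendsto_of_complete (Metric.cauchySeq_iff'.2 fun ε hε => ?_)
  obtain ⟨n, hn⟩ := exists_nat_one_div_lt hε
  obtain ⟨m, hm⟩ := hω n
  exact ⟨m, fun N hN => by
    rw [dist_eq_norm]
    exact (hm N hN).trans_lt hn⟩

/-- A sufficient condition for almost sure convergence of a multiple series of independent
symmetric random variables in the rectangular sense. -/
theorem convergesRectAS_of_summable {d : ℕ} {Ω : Type*} [MeasurableSpace Ω]
    {μ : Measure Ω} [IsProbabilityMeasure μ] {X : (Fin d → ℕ) → Ω → ℂ}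
    (hX : ∀ k, Measurable (X k)) (hi : iIndepFun X μ)
    (hs : ∀ k, IdentDistrib (X k) (fun ω => -X k ω) μ μ)
    (hsum : Summable fun k => ∫ ω, min 1 (‖X k ω‖ ^ 2) ∂μ) : ConvergesRectAS μ X := by
  classical
  -- The truncation is odd, so the truncated terms stay symmetric and no centring series appears.
  set f : ℂ → ℂ := fun z => if ‖z‖ ≤ 1 then z else 0 with hf
  have hfm : Measurable f :=
    Measurable.ite (measurableSet_le measurable_norm measurable_const) measurable_id
      measurable_const
  have hfneg : ∀ z, f (-z) = -f z := fun z => by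
    simp only [hf, norm_neg]
    split_ifs <;> simp
  have hf1 : ∀ z, ‖f z‖ ≤ 1 := fun z => by
    simp only [hf]
    split_ifs with h
    · exact h
    · simp
  have hf2 : ∀ z, ‖f z‖ ^ 2 ≤ min 1 (‖z‖ ^ 2) := fun z => by
    refine le_min (pow_le_one₀ (norm_nonneg _) (hf1 z)) ?_
    simp only [hf]
    split_ifs
    · exact le_rfl
    · simp
  have hmin : ∀ k, Integrable (fun ω => min 1 (‖X k ω‖ ^ 2)) μ := fun k =>
    Integrable.of_bound (measurable_const.min ((hX k).norm.pow_const 2)).aestronglyMeasurable 1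
      (ae_of_all _ fun ω => by
        rw [Real.norm_eq_abs, abs_of_nonneg (le_min zero_le_one (sq_nonneg _))]
        exact min_le_left _ _)
  have hA : ConvergesRectAS μ fun k ω => f (X k ω) := by
    refine ae_exists_hasRectSum_of_bounded (fun k => hfm.comp (hX k)) (fun k ω => hf1 _)
      (hi.comp (fun _ => f) fun _ => hfm) (fun k => ?_) ?_
    · have := (hs k).comp hfm
      simpa only [Function.comp_def, hfneg] using this
    · refine Summable.of_nonneg_of_le (fun k => integral_nonneg fun ω => sq_nonneg _)
        (fun k => integral_mono ?_ (hmin k) fun ω => hf2 _) hsum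
      exact (hmin k).mono ((hfm.comp (hX k)).norm.pow_const 2).aestronglyMeasurable
        (ae_of_all _ fun ω => by
          rw [Real.norm_eq_abs, Real.norm_eq_abs, abs_of_nonneg (sq_nonneg _)]
          exact (hf2 _).trans (le_abs_self _))
  -- Borel–Cantelli: almost surely only finitely many terms are altered by the truncation.
  have hfin : ∀ᵐ ω ∂μ, {k | ω ∈ {ω | 1 < ‖X k ω‖}}.Finite := by
    refine ae_finite_setOfPred_mem (ne_top_of_le_ne_top hsum.tsum_ofReal_ne_top
      (ENNReal.tsum_le_tsum fun k => ?_))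
    have h := mul_meas_ge_le_integral_of_nonneg
      (ae_of_all _ fun ω => le_min zero_le_one (sq_nonneg ‖X k ω‖)) (hmin k) 1
    rw [one_mul] at h
    calc μ {ω | 1 < ‖X k ω‖} ≤ μ {ω | 1 ≤ min 1 (‖X k ω‖ ^ 2)} :=
          measure_mono fun ω hω => by
            have hω' : 1 < ‖X k ω‖ := hω
            exact Set.mem_ofPred_eq ▸ le_min le_rfl (one_le_pow₀ hω'.le)
      _ = ENNReal.ofReal (μ.real {ω | 1 ≤ min 1 (‖X k ω‖ ^ 2)}) := by rw [ofReal_measureReal]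
      _ ≤ _ := ENNReal.ofReal_le_ofReal h
  filter_upwards [hA, hfin] with ω ⟨l, hl⟩ hω
  have h2 : Summable fun k => X k ω - f (X k ω) := by
    refine summable_of_hasFiniteSupport (hω.subset fun k hk => ?_)
    by_contra hcon
    refine hk ?_
    have : ‖X k ω‖ ≤ 1 := not_lt.1 hcon
    simp [hf, this]
  refine ⟨_, (hl.add (hasRectSum_of_hasSum h2.hasSum)).congr fun N => ?_⟩
  simp

/-! ### Necessity: what a causal solution forces on the coefficients. -/

section Noise

variable {d : ℕ} {Ω : Type*} [MeasurableSpace Ω] {μ : Measure Ω} {Z : (Fin d → ℤ) → Ω → ℂ}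

theorem IsIIDNoise.symmetric (hZ : IsIIDNoise μ Z) (hs : IsSymmetric μ Z) (t : Fin d → ℤ) :
    IdentDistrib (Z t) (fun ω => -Z t ω) μ μ :=
  ((hZ.ident t 0).trans hs).trans ((hZ.ident 0 t).comp measurable_neg)

theorem IsIIDNoise.not_ae_eq_zero (hZ : IsIIDNoise μ Z) (hd : ¬ IsDeterministic μ Z)
    (t : Fin d → ℤ) : ¬ ∀ᵐ ω ∂μ, Z t ω = 0 := fun h =>
  hd ⟨0, fun s => (hZ.ident t s).ae_snd (p := fun z => z = 0) (measurableSet_singleton 0) h⟩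

theorem IsIIDNoise.iIndepFun_terms (hZ : IsIIDNoise μ Z) (α : (Fin d → ℕ) → ℂ)
    (t : Fin d → ℤ) : iIndepFun (fun k ω => α k * Z (back t k) ω) μ :=
  (hZ.indep.precomp (back_injective t)).comp (fun k z => α k * z) fun k => by fun_prop

theorem IsIIDNoise.measurable_terms (hZ : IsIIDNoise μ Z) (α : (Fin d → ℕ) → ℂ)
    (t : Fin d → ℤ) (k : Fin d → ℕ) : Measurable fun ω => α k * Z (back t k) ω :=
  (hZ.measurable _).const_mul _

theorem IsIIDNoise.symmetric_terms (hZ : IsIIDNoise μ Z) (hs : IsSymmetric μ Z)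
    (α : (Fin d → ℕ) → ℂ) (t : Fin d → ℤ) (k : Fin d → ℕ) :
    IdentDistrib (fun ω => α k * Z (back t k) ω) (fun ω => -(α k * Z (back t k) ω)) μ μ := by
  have := (hZ.symmetric hs (back t k)).comp (u := fun z => α k * z) (by fun_prop)
  simpa only [Function.comp_def, mul_neg] using this

theorem integrable_min_one_sq [IsFiniteMeasure μ] {X : Ω → ℝ} (hX : Measurable X) :
    Integrable (fun ω => min 1 (X ω ^ 2)) μ :=
  Integrable.of_bound (measurable_const.min (hX.pow_const 2)).aestronglyMeasurable 1
    (ae_of_all _ fun ω => by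
      rw [Real.norm_eq_abs, abs_of_nonneg (le_min zero_le_one (sq_nonneg _))]
      exact min_le_left _ _)

variable [IsProbabilityMeasure μ] {R S : Finset (Fin d → ℕ)} {φ θ α : (Fin d → ℕ) → ℂ}
  {Y : (Fin d → ℤ) → Ω → ℂ}

/-- The box decomposition of `Y t`, pushed through a real functional, is the hypothesis of
`summable_integral_min_one_sq`; a finite index set lies in the box below its supremum. -/
theorem IsCausalSolution.summable_clm (hR : 0 ∉ R) (hZ : IsIIDNoise μ Z)
    (hs : IsSymmetric μ Z) (hY : IsCausalSolution μ R S φ θ Z Y)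
    (hα : IsRecursive R S φ θ α) (t : Fin d → ℤ) (L : ℂ →L[ℝ] ℝ) :
    Summable fun k => ∫ ω, min 1 (L (α k * Z (back t k) ω) ^ 2) ∂μ := by
  have hYm : Measurable (Y t) :=
    (hY.causal t).mono (fieldSigma_le hZ.measurable (Set.Iic t)) le_rfl
  have hL : Measurable L := L.continuous.measurable
  refine summable_integral_min_one_sq (V := fun k ω => L (α k * Z (back t k) ω))
    (W := fun ω => L (Y t ω)) (fun k => hL.comp (hZ.measurable_terms α t k))
    ((hZ.iIndepFun_terms α t).comp (fun _ => L) fun _ => hL)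
    (fun k => ?_) (hL.comp hYm).aemeasurable fun F => ?_
  · simpa only [Function.comp_def, map_neg] using (hZ.symmetric_terms hs α t k).comp hL
  · obtain ⟨T, hT, hind, hYT⟩ := hY.exists_indepFun_remainder hR hZ hα t (F.sup id)
    have hsum : ∀ ω, ∑ k ∈ Finset.Iic (F.sup id), L (α k * Z (back t k) ω) =
        L (rectPartialSum (fun k => α k * Z (back t k) ω) (F.sup id)) := fun ω => by
      rw [rectPartialSum, map_sum]
    refine ⟨Finset.Iic (F.sup id), fun k hk => Finset.mem_Iic.2 (Finset.le_sup (f := id) hk),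
      fun ω => L (T ω), hL.comp hT, ?_, ?_⟩
    · simp only [hsum]
      exact hind.comp hL hL
    · filter_upwards [hYT] with ω hω
      rw [hω, map_add, hsum]

/-- The terms of the series attached to a causal solution have summable truncated second moments. -/
theorem IsCausalSolution.summable_min_one_norm_sq (hR : 0 ∉ R) (hZ : IsIIDNoise μ Z)
    (hs : IsSymmetric μ Z) (hY : IsCausalSolution μ R S φ θ Z Y)
    (hα : IsRecursive R S φ θ α) (t : Fin d → ℤ) :
    Summable fun k => ∫ ω, min 1 (‖α k * Z (back t k) ω‖ ^ 2) ∂μ := by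
  have h1 := hY.summable_clm hR hZ hs hα t Complex.reCLM
  have h2 := hY.summable_clm hR hZ hs hα t Complex.imCLM
  refine Summable.of_nonneg_of_le
    (fun k => integral_nonneg fun ω => le_min zero_le_one (sq_nonneg _)) (fun k => ?_) (h1.add h2)
  have hm := hZ.measurable_terms α t k
  have hi1 := integrable_min_one_sq (μ := μ) (Complex.measurable_re.comp hm)
  have hi2 := integrable_min_one_sq (μ := μ) (Complex.measurable_im.comp hm)
  rw [← integral_add (by exact hi1) (by exact hi2)]
  refine integral_mono (integrable_min_one_sq hm.norm) (hi1.add hi2) fun ω => ?_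
  simp only [Complex.reCLM_apply, Complex.imCLM_apply]
  set z := α k * Z (back t k) ω
  have hn : ‖z‖ ^ 2 = z.re ^ 2 + z.im ^ 2 := by
    rw [← Complex.normSq_eq_norm_sq, Complex.normSq_apply]
    ring
  rw [hn]
  rcases min_choice 1 (z.re ^ 2) with h | h <;> rcases min_choice 1 (z.im ^ 2) with h' | h' <;>
    rw [h, h']
  · linarith [min_le_left 1 (z.re ^ 2 + z.im ^ 2)]
  · linarith [min_le_left 1 (z.re ^ 2 + z.im ^ 2), sq_nonneg z.im]
  · linarith [min_le_left 1 (z.re ^ 2 + z.im ^ 2), sq_nonneg z.re]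
  · exact min_le_right _ _

theorem IsCausalSolution.convergesRectAS (hR : 0 ∉ R) (hZ : IsIIDNoise μ Z)
    (hs : IsSymmetric μ Z) (hY : IsCausalSolution μ R S φ θ Z Y)
    (hα : IsRecursive R S φ θ α) (t : Fin d → ℤ) :
    ConvergesRectAS μ (fun k ω => α k * Z (back t k) ω) :=
  convergesRectAS_of_summable (hZ.measurable_terms α t) (hZ.iIndepFun_terms α t)
    (hZ.symmetric_terms hs α t) (hY.summable_min_one_norm_sq hR hZ hs hα t)

/-- Since `min 1 a * min 1 b ≤ min 1 (a * b)`, the truncated moments dominate `min 1 (‖α k‖ ^ 2)`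
times `E min(1, |Z|²)`, which is positive because `Z` is not almost surely `0`. Summability makes
the remaining minimum inactive for all but finitely many `k`. -/
theorem IsCausalSolution.summable_norm_sq (hR : 0 ∉ R) (hZ : IsIIDNoise μ Z)
    (hs : IsSymmetric μ Z) (hd : ¬ IsDeterministic μ Z) (hY : IsCausalSolution μ R S φ θ Z Y)
    (hα : IsRecursive R S φ θ α) : Summable fun k => ‖α k‖ ^ 2 := by
  set m : ℝ := ∫ ω, min 1 (‖Z 0 ω‖ ^ 2) ∂μ with hm
  have hm0 : 0 < m := by
    refine lt_of_le_of_ne (integral_nonneg fun ω => le_min zero_le_one (sq_nonneg _)) fun h => ?_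
    have h1 := (integral_eq_zero_iff_of_nonneg (fun ω => le_min zero_le_one (sq_nonneg _))
      (integrable_min_one_sq (μ := μ) (hZ.measurable 0).norm)).1 (hm ▸ h).symm
    refine hZ.not_ae_eq_zero hd 0 ?_
    filter_upwards [h1] with ω hω
    by_contra hne
    have : 0 < min 1 (‖Z 0 ω‖ ^ 2) := lt_min one_pos (by positivity)
    exact this.ne' hω
  have hmin : ∀ a b : ℝ, 0 ≤ a → 0 ≤ b → min 1 a * min 1 b ≤ min 1 (a * b) := by
    intro a b ha hb
    refine le_min (mul_le_one₀ (min_le_left _ _) (le_min zero_le_one hb) (min_le_left _ _))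
      (mul_le_mul (min_le_right _ _) (min_le_right _ _) (le_min zero_le_one hb) ha)
  have h1 : Summable fun k => min 1 (‖α k‖ ^ 2) := by
    have h2 := (hY.summable_min_one_norm_sq hR hZ hs hα 0).mul_right m⁻¹
    refine Summable.of_nonneg_of_le (fun k => le_min zero_le_one (sq_nonneg _)) (fun k => ?_) h2
    rw [← div_eq_mul_inv, le_div_iff₀ hm0]
    have h3 : m = ∫ ω, min 1 (‖Z (back 0 k) ω‖ ^ 2) ∂μ :=
      ((hZ.ident 0 (back 0 k)).comp (u := fun z => min 1 (‖z‖ ^ 2))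
        (measurable_const.min (measurable_norm.pow_const 2))).integral_eq
    rw [h3, ← integral_const_mul]
    refine integral_mono ((integrable_min_one_sq (hZ.measurable _).norm).const_mul _)
      (integrable_min_one_sq (hZ.measurable_terms α 0 k).norm) fun ω => ?_
    simp only [norm_mul, mul_pow]
    exact hmin _ _ (sq_nonneg _) (sq_nonneg _)
  refine h1.congr_cofinite ?_
  filter_upwards [h1.tendsto_cofinite_zero.eventually (gt_mem_nhds one_pos)] with k hk
  rcases min_lt_iff.1 hk with h | h
  · exact absurd h (lt_irrefl _)
  · exact min_eq_right h.le

end Noise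

/-! ### Power series on the polydisc. -/

theorem summable_prod_apply {d : ℕ} {g : ℕ → ℝ} (h0 : ∀ n, 0 ≤ g n) (hg : Summable g) :
    Summable fun k : Fin d → ℕ => ∏ i, g (k i) := by
  classical
  refine summable_of_sum_le (c := ∏ _i : Fin d, ∑' n, g n)
    (fun k => Finset.prod_nonneg fun i _ => h0 _) fun F => ?_
  have h1 : F ⊆ Fintype.piFinset fun i => F.image fun k => k i := fun k hk =>
    Fintype.mem_piFinset.2 fun i => Finset.mem_image_of_mem (fun k : Fin d → ℕ => k i) hk
  calc ∑ k ∈ F, ∏ i, g (k i)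
      ≤ ∑ k ∈ Fintype.piFinset fun i => F.image fun k => k i, ∏ i, g (k i) :=
        Finset.sum_le_sum_of_subset_of_nonneg h1 fun k _ _ => Finset.prod_nonneg fun i _ => h0 _
    _ = ∏ i : Fin d, ∑ n ∈ F.image fun k => k i, g n := (Finset.prod_univ_sum _ _).symm
    _ ≤ ∏ _i : Fin d, ∑' n, g n :=
        Finset.prod_le_prod (fun i _ => Finset.sum_nonneg fun n _ => h0 n)
          fun i _ => hg.sum_le_tsum _ fun n _ => h0 n

theorem mem_polydisc_iff {d : ℕ} {z : Fin d → ℂ} : z ∈ polydisc d ↔ ‖z‖ < 1 := by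
  rw [pi_norm_lt_iff one_pos]
  rfl

theorem norm_monomial_le {d : ℕ} {z : Fin d → ℂ} {r : ℝ} (hz : ‖z‖ ≤ r) (k : Fin d → ℕ) :
    ‖monomial z k‖ ≤ ∏ i, r ^ k i := by
  rw [monomial, norm_prod]
  refine Finset.prod_le_prod (fun i _ => norm_nonneg _) fun i _ => ?_
  rw [norm_pow]
  gcongr
  exact (norm_le_pi_norm z i).trans hz

theorem summable_prod_pow {d : ℕ} {r : ℝ} (h0 : 0 ≤ r) (h1 : r < 1) :
    Summable fun k : Fin d → ℕ => ∏ i, r ^ k i :=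
  summable_prod_apply (fun n => pow_nonneg h0 n) (summable_geometric_of_lt_one h0 h1)

theorem summable_mul_monomial {d : ℕ} {α : (Fin d → ℕ) → ℂ} {C : ℝ} (hC : ∀ k, ‖α k‖ ≤ C)
    {z : Fin d → ℂ} (hz : z ∈ polydisc d) : Summable fun k => α k * monomial z k := by
  refine Summable.of_norm_bounded
    ((summable_prod_pow (norm_nonneg z) (mem_polydisc_iff.1 hz)).mul_left C) fun k => ?_
  rw [norm_mul]
  exact mul_le_mul (hC k) (norm_monomial_le le_rfl k) (norm_nonneg _)
    ((norm_nonneg _).trans (hC k))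

theorem hasFDerivAt_monomial {d : ℕ} (k : Fin d → ℕ) (z : Fin d → ℂ) :
    HasFDerivAt (fun z => monomial z k) (∑ i, (∏ j ∈ Finset.univ.erase i, z j ^ k j) •
      (((k i : ℂ) * z i ^ (k i - 1)) • ContinuousLinearMap.proj (R := ℂ) (φ := fun _ => ℂ) i)) z := by
  unfold monomial
  exact HasFDerivAt.finsetProd fun i _ => (hasDerivAt_pow (k i) (z i)).comp_hasFDerivAt z
    (hasFDerivAt_apply (𝕜 := ℂ) i z)

/-- A bound uniform on the ball of radius `r` and of product form, so that it is summable over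
multi-indices as soon as `∑ (n + 1) rⁿ` converges. -/
theorem norm_fderiv_monomial_le {d : ℕ} (k : Fin d → ℕ) {z : Fin d → ℂ} {r : ℝ} (hr : 0 < r)
    (hz : ‖z‖ ≤ r) : ‖fderiv ℂ (fun z => monomial z k) z‖ ≤
      d * r⁻¹ * ∏ i, (((k i : ℝ) + 1) * r ^ k i) := by
  rw [(hasFDerivAt_monomial k z).fderiv]
  have hzi : ∀ i, ‖z i‖ ≤ r := fun i => (norm_le_pi_norm z i).trans hz
  have hterm : ∀ i : Fin d, ‖(∏ j ∈ Finset.univ.erase i, z j ^ k j) •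
      (((k i : ℂ) * z i ^ (k i - 1)) •
        ContinuousLinearMap.proj (R := ℂ) (φ := fun _ : Fin d => ℂ) i)‖ ≤
      r⁻¹ * ∏ i, (((k i : ℝ) + 1) * r ^ k i) := by
    intro i
    have hproj : ‖ContinuousLinearMap.proj (R := ℂ) (φ := fun _ : Fin d => ℂ) i‖ ≤ 1 :=
      ContinuousLinearMap.opNorm_le_bound _ zero_le_one fun x => by
        rw [one_mul]
        exact norm_le_pi_norm x i
    have h1 : ‖∏ j ∈ Finset.univ.erase i, z j ^ k j‖ ≤
        ∏ j ∈ Finset.univ.erase i, (((k j : ℝ) + 1) * r ^ k j) := by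
      rw [norm_prod]
      refine Finset.prod_le_prod (fun j _ => norm_nonneg _) fun j _ => ?_
      rw [norm_pow]
      calc ‖z j‖ ^ k j ≤ r ^ k j := by gcongr; exact hzi j
        _ ≤ ((k j : ℝ) + 1) * r ^ k j :=
          le_mul_of_one_le_left (by positivity) (by linarith [(Nat.cast_nonneg (k j) : (0:ℝ) ≤ _)])
    have h2 : ‖(k i : ℂ) * z i ^ (k i - 1)‖ ≤ r⁻¹ * (((k i : ℝ) + 1) * r ^ k i) := by
      rw [norm_mul, norm_pow, Complex.norm_natCast]
      rcases Nat.eq_zero_or_pos (k i) with h | h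
      · simp [h, hr.le]
      · have h3 : r⁻¹ * r ^ k i = r ^ (k i - 1) := by
          obtain ⟨n, hn⟩ := Nat.exists_eq_succ_of_ne_zero h.ne'
          rw [hn, Nat.succ_sub_one, pow_succ']
          field_simp
        calc (k i : ℝ) * ‖z i‖ ^ (k i - 1) ≤ ((k i : ℝ) + 1) * r ^ (k i - 1) := by
              gcongr
              · linarith
              · exact hzi i
          _ = r⁻¹ * (((k i : ℝ) + 1) * r ^ k i) := by rw [← h3]; ring
    rw [norm_smul, norm_smul, ← Finset.mul_prod_erase Finset.univ _ (Finset.mem_univ i)]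
    calc _ ≤ (∏ j ∈ Finset.univ.erase i, (((k j : ℝ) + 1) * r ^ k j)) *
          (r⁻¹ * (((k i : ℝ) + 1) * r ^ k i) * 1) := by
            gcongr
      _ = _ := by ring
  refine (norm_sum_le _ _).trans ((Finset.sum_le_sum fun i _ => hterm i).trans (le_of_eq ?_))
  simp
  ring

theorem differentiableOn_tsum_monomial {d : ℕ} {α : (Fin d → ℕ) → ℂ} {C : ℝ}
    (hC : ∀ k, ‖α k‖ ≤ C) :
    DifferentiableOn ℂ (fun z => ∑' k, α k * monomial z k) (polydisc d) := by
  intro z hz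
  obtain ⟨r, hzr, hr1⟩ := exists_between (mem_polydisc_iff.1 hz)
  have hr0 : 0 < r := (norm_nonneg z).trans_lt hzr
  have hC0 : 0 ≤ C := (norm_nonneg _).trans (hC 0)
  have hg : Summable fun n : ℕ => ((n : ℝ) + 1) * r ^ n := by
    have h1 := summable_pow_mul_geometric_of_norm_lt_one 1
      (show ‖r‖ < 1 by rwa [Real.norm_of_nonneg hr0.le])
    simpa only [pow_one, add_mul, one_mul] using h1.add (summable_geometric_of_lt_one hr0.le hr1)
  have hu := (summable_prod_apply (d := d) (fun n => by positivity) hg).mul_left (C * (d * r⁻¹))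
  have h := hasFDerivAt_tsum_of_isPreconnected (𝕜 := ℂ) (f := fun k z => α k * monomial z k)
    (f' := fun k z => α k • fderiv ℂ (fun z => monomial z k) z)
    (s := Metric.ball (0 : Fin d → ℂ) r) (x₀ := z) (x := z) hu Metric.isOpen_ball
    (convex_ball _ _).isPreconnected
    (fun k w _ => (hasFDerivAt_monomial k w).differentiableAt.hasFDerivAt.const_mul (α k))
    (fun k w hw => ?_) (by simpa using hzr) (summable_mul_monomial hC hz) (by simpa using hzr)
  · exact h.differentiableAt.differentiableWithinAt
  · rw [norm_smul, mul_assoc C]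
    exact mul_le_mul (hC k) (norm_fderiv_monomial_le k hr0 (by simpa using (mem_ball_zero_iff.1 hw).le))
      (norm_nonneg _) hC0

theorem monomial_add {d : ℕ} (z : Fin d → ℂ) (m n : Fin d → ℕ) :
    monomial z (m + n) = monomial z m * monomial z n := by
  simp only [monomial, Pi.add_apply, pow_add, Finset.prod_mul_distrib]

theorem monomial_zero_right {d : ℕ} (z : Fin d → ℂ) : monomial z 0 = 1 := by
  simp [monomial]

theorem monomial_mul {d : ℕ} (z w : Fin d → ℂ) (k : Fin d → ℕ) :
    monomial (fun i => z i * w i) k = monomial z k * monomial w k := by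
  simp only [monomial, mul_pow, Finset.prod_mul_distrib]

theorem hasSum_maCoeff {d : ℕ} (S : Finset (Fin d → ℕ)) (θ : (Fin d → ℕ) → ℂ) (z : Fin d → ℂ) :
    HasSum (fun k => maCoeff S θ k * monomial z k) (maPoly S θ z) := by
  classical
  simp only [maCoeff, maPoly, add_mul, Finset.sum_mul]
  refine HasSum.add ?_ (hasSum_sum fun n _ => ?_)
  · convert! hasSum_ite_eq (0 : Fin d → ℕ) (1 : ℂ) using 2 with k
    split_ifs with h
    · rw [h, monomial_zero_right, mul_one]
    · rw [zero_mul]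
  · convert! hasSum_ite_eq n (θ n * monomial z n) using 2 with k
    split_ifs with h
    · rw [h]
    · rw [zero_mul]

open scoped Classical in
theorem hasSum_shift {d : ℕ} {α : (Fin d → ℕ) → ℂ} {z : Fin d → ℂ} {s : ℂ}
    (h : HasSum (fun k => α k * monomial z k) s) (n : Fin d → ℕ) (c : ℂ) :
    HasSum (fun k => (if n ≤ k then c * α (k - n) else 0) * monomial z k)
      (c * monomial z n * s) := by
  have hinj : Function.Injective fun k : Fin d → ℕ => n + k := add_right_injective n
  rw [← hinj.hasSum_iff]
  · convert! h.mul_left (c * monomial z n) using 2 with k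
    simp only [Function.comp_apply, le_add_iff_nonneg_right, zero_le, if_true,
      add_tsub_cancel_left, monomial_add]
    ring
  · intro k hk
    rw [if_neg, zero_mul]
    exact fun hnk => hk ⟨k - n, add_tsub_cancel_of_le hnk⟩

-- The power series of `Φ f - Θ` has the defects of the recursion as coefficients. Both directions
-- between the recursion and the quotient are read off from this.
open scoped Classical in
theorem hasSum_residual {d : ℕ} (R S : Finset (Fin d → ℕ)) (φ θ : (Fin d → ℕ) → ℂ)
    {α : (Fin d → ℕ) → ℂ} {z : Fin d → ℂ} {s : ℂ}
    (h : HasSum (fun k => α k * monomial z k) s) :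
    HasSum (fun k => (α k - (maCoeff S θ k + ∑ n ∈ R, if n ≤ k then φ n * α (k - n) else 0)) *
      monomial z k) (arPoly R φ z * s - maPoly S θ z) := by
  have h1 := hasSum_sum (s := R) fun n _ => hasSum_shift h n (φ n)
  convert! h.sub ((hasSum_maCoeff S θ z).add h1) using 1
  · funext k
    rw [sub_mul, add_mul, Finset.sum_mul]
  · rw [arPoly, ← Finset.sum_mul]
    ring

theorem IsRecursive.isQuotient {d : ℕ} {R S : Finset (Fin d → ℕ)} {φ θ α : (Fin d → ℕ) → ℂ}
    (hα : IsRecursive R S φ θ α) {f : (Fin d → ℂ) → ℂ} (hf : HasExpansion f α) :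
    IsQuotient R S φ θ f := by
  classical
  intro z hz hΦ
  have h := hasSum_residual R S φ θ (hf z hz)
  have h0 : ∀ k, (α k - (maCoeff S θ k + ∑ n ∈ R, if n ≤ k then φ n * α (k - n) else 0)) *
      monomial z k = 0 := fun k => by rw [← hα k, sub_self, zero_mul]
  simp only [h0] at h
  rw [eq_div_iff hΦ, mul_comm]
  exact sub_eq_zero.1 (h.unique hasSum_zero)

/-! ### Fourier orthogonality, the Hardy norm, and identification of coefficients. -/

/-- The point `(e^{-it_1}, …, e^{-it_d})` of the torus. -/
noncomputable def torusPoint {d : ℕ} (t : Fin d → ℝ) : Fin d → ℂ :=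
  fun i => Complex.exp (-(Complex.I * (t i : ℂ)))

/-- Lebesgue measure on the cube `(-π, π]^d`. -/
noncomputable def cubeMeasure (d : ℕ) : Measure (Fin d → ℝ) :=
  volume.restrict (Set.pi Set.univ fun _ : Fin d => Set.Ioc (-Real.pi) Real.pi)

theorem cubeMeasure_eq_pi (d : ℕ) :
    cubeMeasure d = Measure.pi fun _ : Fin d => volume.restrict (Set.Ioc (-Real.pi) Real.pi) := by
  rw [cubeMeasure, volume_pi, Measure.restrict_pi_pi]

instance (d : ℕ) : IsFiniteMeasure (cubeMeasure d) := by
  rw [cubeMeasure_eq_pi]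
  infer_instance

theorem norm_torusPoint {d : ℕ} (t : Fin d → ℝ) (i : Fin d) : ‖torusPoint t i‖ = 1 := by
  rw [torusPoint, ← mul_neg, mul_comm, ← Complex.ofReal_neg, Complex.norm_exp_ofReal_mul_I]

theorem norm_monomial_torusPoint {d : ℕ} (t : Fin d → ℝ) (k : Fin d → ℕ) :
    ‖monomial (torusPoint t) k‖ = 1 := by
  simp [monomial, norm_torusPoint]

theorem continuous_monomial_torusPoint {d : ℕ} (k : Fin d → ℕ) :
    Continuous fun t : Fin d → ℝ => monomial (torusPoint t) k := by
  unfold monomial torusPoint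
  fun_prop

theorem integral_exp_int_mul (n : ℤ) :
    ∫ t in Set.Ioc (-Real.pi) Real.pi, Complex.exp (n * Complex.I * t) =
      if n = 0 then 2 * (Real.pi : ℂ) else 0 := by
  rw [← intervalIntegral.integral_of_le (by linarith [Real.pi_pos])]
  split_ifs with h
  · simp only [h, Int.cast_zero, zero_mul, Complex.exp_zero, intervalIntegral.integral_const]
    simp
    ring
  · have hn : (n : ℂ) * Complex.I ≠ 0 :=
      mul_ne_zero (Int.cast_ne_zero.2 h) Complex.I_ne_zero
    rw [integral_exp_mul_complex hn, div_eq_zero_iff]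
    left
    rw [sub_eq_zero, Complex.exp_eq_exp_iff_exists_int]
    refine ⟨n, ?_⟩
    push_cast
    ring

/-- Orthogonality of the monomials on the torus. -/
theorem integral_monomial_mul_conj {d : ℕ} (k l : Fin d → ℕ) :
    ∫ t, monomial (torusPoint t) k * (starRingEnd ℂ) (monomial (torusPoint t) l) ∂cubeMeasure d =
      if k = l then (2 * (Real.pi : ℂ)) ^ d else 0 := by
  have h1 : ∀ t : Fin d → ℝ, monomial (torusPoint t) k *
      (starRingEnd ℂ) (monomial (torusPoint t) l) =
      ∏ i, Complex.exp ((((l i : ℤ) - (k i : ℤ) : ℤ) : ℂ) * Complex.I * t i) := fun t => by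
    simp only [monomial, torusPoint, map_prod, map_pow, ← Finset.prod_mul_distrib]
    refine Finset.prod_congr rfl fun i _ => ?_
    rw [← Complex.exp_conj, ← Complex.exp_nat_mul, ← Complex.exp_nat_mul, ← Complex.exp_add]
    congr 1
    simp only [map_neg, map_mul, Complex.conj_I, Complex.conj_ofReal]
    push_cast
    ring
  simp only [h1]
  rw [cubeMeasure_eq_pi, integral_fintype_prod_eq_prod
    (f := fun i (x : ℝ) => Complex.exp ((((l i : ℤ) - (k i : ℤ) : ℤ) : ℂ) * Complex.I * x))]
  simp only [integral_exp_int_mul]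
  split_ifs with h
  · simp [h]
  · obtain ⟨i, hi⟩ := Function.ne_iff.1 h
    refine Finset.prod_eq_zero (Finset.mem_univ i) (if_neg ?_)
    omega

theorem integrable_monomial_mul_conj {d : ℕ} (k l : Fin d → ℕ) :
    Integrable (fun t => monomial (torusPoint t) k *
      (starRingEnd ℂ) (monomial (torusPoint t) l)) (cubeMeasure d) :=
  Integrable.of_bound ((continuous_monomial_torusPoint k).mul
    (Complex.continuous_conj.comp (continuous_monomial_torusPoint l))).aestronglyMeasurable 1
    (ae_of_all _ fun t => by simp [norm_monomial_torusPoint])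

theorem integral_norm_sq_sum_monomial {d : ℕ} (F : Finset (Fin d → ℕ)) (a : (Fin d → ℕ) → ℂ) :
    ∫ t, ‖∑ k ∈ F, a k * monomial (torusPoint t) k‖ ^ 2 ∂cubeMeasure d =
      (2 * Real.pi) ^ d * ∑ k ∈ F, ‖a k‖ ^ 2 := by
  classical
  have h1 : ∀ t : Fin d → ℝ, ((‖∑ k ∈ F, a k * monomial (torusPoint t) k‖ ^ 2 : ℝ) : ℂ) =
      ∑ k ∈ F, ∑ l ∈ F, a k * (starRingEnd ℂ) (a l) * (monomial (torusPoint t) k *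
        (starRingEnd ℂ) (monomial (torusPoint t) l)) := fun t => by
    rw [Complex.ofReal_pow, ← Complex.mul_conj', map_sum, Finset.sum_mul_sum]
    refine Finset.sum_congr rfl fun k _ => Finset.sum_congr rfl fun l _ => ?_
    rw [map_mul]
    ring
  apply Complex.ofReal_injective
  rw [← integral_complex_ofReal]
  simp only [h1]
  rw [integral_finsetSum _ fun k _ => integrable_finsetSum _ fun l _ =>
    (integrable_monomial_mul_conj k l).const_mul _]
  have h2 : ∀ k ∈ F, ∫ t, ∑ l ∈ F, a k * (starRingEnd ℂ) (a l) * (monomial (torusPoint t) k *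
        (starRingEnd ℂ) (monomial (torusPoint t) l)) ∂cubeMeasure d =
      (2 * (Real.pi : ℂ)) ^ d * (‖a k‖ : ℂ) ^ 2 := fun k hk => by
    rw [integral_finsetSum _ fun l _ => (integrable_monomial_mul_conj k l).const_mul _]
    simp only [integral_const_mul, integral_monomial_mul_conj]
    rw [Finset.sum_eq_single k]
    · rw [if_pos rfl, Complex.mul_conj', mul_comm]
    · intro l _ hl
      rw [if_neg hl.symm, mul_zero]
    · exact fun h => absurd hk h
  rw [Finset.sum_congr rfl h2, ← Finset.mul_sum]
  push_cast
  rfl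

theorem smul_torusPoint_mem_polydisc {d : ℕ} {r : ℝ} (h0 : 0 ≤ r) (h1 : r < 1) (t : Fin d → ℝ) :
    (fun i => (r : ℂ) * torusPoint t i) ∈ polydisc d := fun i => by
  rwa [norm_mul, norm_torusPoint, mul_one, Complex.norm_real, Real.norm_of_nonneg h0]

/-- Square summable coefficients give a finite Hardy norm. -/
theorem hardyNormSq_lt_top {d : ℕ} {f : (Fin d → ℂ) → ℂ} {α : (Fin d → ℕ) → ℂ}
    (hf : HasExpansion f α) (hα : Summable fun k => ‖α k‖ ^ 2) : hardyNormSq f < ⊤ := by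
  have hbound : ∀ r ∈ Set.Ico (0 : ℝ) 1, ∫⁻ t, ‖f (fun i => (r : ℂ) * torusPoint t i)‖ₑ ^ 2
      ∂cubeMeasure d ≤ ENNReal.ofReal ((2 * Real.pi) ^ d * ∑' k, ‖α k‖ ^ 2) := by
    intro r hr
    -- The radius is absorbed into the coefficients, which only decrease in modulus, so the bound is
    -- uniform in `r`.
    set a : (Fin d → ℕ) → ℂ := fun k => α k * monomial (fun _ => (r : ℂ)) k with ha
    have hak : ∀ k, ‖a k‖ ≤ ‖α k‖ := fun k => by
      rw [ha, norm_mul]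
      refine mul_le_of_le_one_right (norm_nonneg _) ?_
      rw [monomial, norm_prod]
      refine Finset.prod_le_one (fun i _ => norm_nonneg _) fun i _ => ?_
      rw [norm_pow, Complex.norm_real, Real.norm_of_nonneg hr.1]
      exact pow_le_one₀ hr.1 hr.2.le
    set s : ℕ → (Fin d → ℝ) → ℂ := fun n t =>
      ∑ k ∈ Finset.Iic (fun _ => n : Fin d → ℕ), a k * monomial (torusPoint t) k with hs
    have hcont : ∀ n, Continuous (s n) := fun n =>
      continuous_finsetSum _ fun k _ => continuous_const.mul (continuous_monomial_torusPoint k)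
    have hlim : ∀ t, Tendsto (fun n => s n t) atTop (𝓝 (f fun i => (r : ℂ) * torusPoint t i)) := by
      intro t
      have h1 := hf _ (smul_torusPoint_mem_polydisc hr.1 hr.2 t)
      have h2 : HasSum (fun k => a k * monomial (torusPoint t) k)
          (f fun i => (r : ℂ) * torusPoint t i) := by
        convert! h1 using 2 with k
        rw [monomial_mul (fun _ => (r : ℂ)), ha, mul_assoc]
      have h3 : Tendsto (fun n : ℕ => (fun _ => n : Fin d → ℕ)) atTop atTop :=
        tendsto_atTop.2 fun N => by
          filter_upwards [eventually_ge_atTop (Finset.univ.sup N)] with n hn i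
          exact (Finset.le_sup (Finset.mem_univ i)).trans hn
      exact (hasRectSum_of_hasSum h2).comp h3
    have hn : ∀ n, ∫⁻ t, ‖s n t‖ₑ ^ 2 ∂cubeMeasure d ≤
        ENNReal.ofReal ((2 * Real.pi) ^ d * ∑' k, ‖α k‖ ^ 2) := fun n => by
      have h1 : ∀ t, ‖s n t‖ₑ ^ 2 = ENNReal.ofReal (‖s n t‖ ^ 2) := fun t => by
        rw [ENNReal.ofReal_pow (norm_nonneg _), ofReal_norm]
      have h2 : Integrable (fun t => ‖s n t‖ ^ 2) (cubeMeasure d) := by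
        refine (MemLp.of_bound (p := 2) (hcont n).norm.aestronglyMeasurable
          (∑ k ∈ Finset.Iic (fun _ => n : Fin d → ℕ), ‖a k‖) (ae_of_all _ fun t => ?_)).integrable_sq
        rw [norm_norm]
        refine (norm_sum_le _ _).trans (le_of_eq (Finset.sum_congr rfl fun k _ => ?_))
        rw [norm_mul, norm_monomial_torusPoint, mul_one]
      simp only [h1]
      rw [← ofReal_integral_eq_lintegral_ofReal h2 (ae_of_all _ fun t => sq_nonneg _),
        integral_norm_sq_sum_monomial]
      refine ENNReal.ofReal_le_ofReal (mul_le_mul_of_nonneg_left ?_ (by positivity))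
      refine (Finset.sum_le_sum fun k _ => ?_).trans (hα.sum_le_tsum _ fun k _ => sq_nonneg _)
      gcongr
      exact hak k
    -- Writing the integrand as a limit inferior prepares Fatou's lemma, with Parseval bounding each
    -- partial sum.
    have h5 : ∀ t, ‖f (fun i => (r : ℂ) * torusPoint t i)‖ₑ ^ 2 =
        liminf (fun n => ‖s n t‖ₑ ^ 2) atTop := fun t =>
      ((ENNReal.continuous_pow 2).continuousAt.tendsto.comp
        ((continuous_enorm.continuousAt.tendsto).comp (hlim t))).liminf_eq.symm
    simp only [h5]
    refine (lintegral_liminf_le fun n => ((hcont n).measurable.enorm.pow_const 2)).trans ?_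
    exact liminf_le_of_le (by isBoundedDefault) fun b hb => by
      obtain ⟨n, hn'⟩ := hb.exists
      exact hn'.trans (hn n)
  refine lt_of_le_of_lt (iSup₂_le fun r hr => mul_le_mul_right (hbound r hr) _) ?_
  exact ENNReal.mul_lt_top ENNReal.ofReal_lt_top ENNReal.ofReal_lt_top

/-- A power series that vanishes on a small torus has vanishing coefficients. -/
theorem eq_zero_of_hasSum_torus {d : ℕ} {c : (Fin d → ℕ) → ℂ} {r : ℝ} (hr : 0 < r)
    (h : ∀ t : Fin d → ℝ, HasSum (fun k => c k * monomial (fun i => (r : ℂ) * torusPoint t i) k) 0) :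
    c = 0 := by
  classical
  funext l
  set a : (Fin d → ℕ) → ℂ := fun k => c k * monomial (fun _ => (r : ℂ)) k with ha
  have hm0 : monomial (fun _ : Fin d => (r : ℂ)) l ≠ 0 :=
    Finset.prod_ne_zero_iff.2 fun i _ => pow_ne_zero _ (Complex.ofReal_ne_zero.2 hr.ne')
  have h1 : ∀ t : Fin d → ℝ, HasSum (fun k => a k * monomial (torusPoint t) k) 0 := fun t => by
    convert! h t using 2 with k
    rw [monomial_mul (fun _ => (r : ℂ)), ha, mul_assoc]
  -- Monomials are unimodular on the torus, so convergence at a single point already gives absolute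
  -- summability, and the series may be integrated termwise against a conjugate monomial.
  have hsum : Summable fun k => ‖a k‖ := by
    have := (h1 0).summable.norm
    simpa only [norm_mul, norm_monomial_torusPoint, mul_one] using this
  have hnorm : ∀ k (t : Fin d → ℝ), ‖a k * (monomial (torusPoint t) k *
      (starRingEnd ℂ) (monomial (torusPoint t) l))‖ = ‖a k‖ := fun k t => by
    simp [norm_monomial_torusPoint]
  have h2 := hasSum_integral_of_summable_integral_norm (μ := cubeMeasure d)
    (F := fun k t => a k * (monomial (torusPoint t) k *
      (starRingEnd ℂ) (monomial (torusPoint t) l)))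
    (fun k => (integrable_monomial_mul_conj k l).const_mul _) (by
      simp only [hnorm, integral_const]
      exact hsum.mul_left _)
  have h3 : ∀ t : Fin d → ℝ, ∑' k, a k * (monomial (torusPoint t) k *
      (starRingEnd ℂ) (monomial (torusPoint t) l)) = 0 := fun t => by
    have := ((h1 t).mul_right ((starRingEnd ℂ) (monomial (torusPoint t) l))).tsum_eq
    simpa only [mul_assoc, zero_mul] using this
  simp only [h3, integral_zero, integral_const_mul, integral_monomial_mul_conj] at h2
  have h4 := h2.unique (hasSum_single l fun k hk => by rw [if_neg hk, mul_zero])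
  rw [if_pos rfl] at h4
  have h5 : a l = 0 := by
    rcases mul_eq_zero.1 h4.symm with h | h
    · exact h
    · exact absurd h (pow_ne_zero _ (mul_ne_zero two_ne_zero
        (Complex.ofReal_ne_zero.2 Real.pi_ne_zero)))
  rcases mul_eq_zero.1 h5 with h | h
  · exact h
  · exact absurd h hm0

theorem arPoly_zero {d : ℕ} {R : Finset (Fin d → ℕ)} (hR : 0 ∉ R) (φ : (Fin d → ℕ) → ℂ) :
    arPoly R φ 0 = 1 := by
  rw [arPoly, Finset.sum_eq_zero, sub_zero]
  intro n hn
  obtain ⟨i, hi⟩ := Function.ne_iff.1 fun h : n = 0 => hR (h ▸ hn)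
  rw [monomial, Finset.prod_eq_zero (Finset.mem_univ i), mul_zero]
  rw [Pi.zero_apply, zero_pow hi]

/-- The coefficients of the power series expansion of `Θ / Φ` satisfy the recursion. -/
theorem IsQuotient.isRecursive {d : ℕ} {R S : Finset (Fin d → ℕ)} (hR : 0 ∉ R)
    {φ θ α : (Fin d → ℕ) → ℂ} {f : (Fin d → ℂ) → ℂ} (hq : IsQuotient R S φ θ f)
    (hf : HasExpansion f α) : IsRecursive R S φ θ α := by
  classical
  have hcont : Continuous (arPoly R φ) := by
    unfold arPoly monomial
    fun_prop
  have hne : ∀ᶠ z in 𝓝 (0 : Fin d → ℂ), arPoly R φ z ≠ 0 :=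
    hcont.continuousAt.eventually_ne (by rw [arPoly_zero hR]; exact one_ne_zero)
  obtain ⟨ε, hε, hball⟩ := Metric.eventually_nhds_iff.1 hne
  -- The quotient is prescribed only where `Φ ≠ 0`; since `Φ(0) = 1`, a small enough torus avoids
  -- the zeros of `Φ`.
  set r : ℝ := min ε 1 / 2 with hr
  have hr0 : 0 < r := by positivity
  have hr1 : r < 1 := by linarith [min_le_right ε 1]
  have hrε : r < ε := by linarith [min_le_left ε 1]
  have h := eq_zero_of_hasSum_torus (d := d) (r := r) hr0 (fun t => by
    have hz := smul_torusPoint_mem_polydisc hr0.le hr1 t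
    have h1 := hasSum_residual R S φ θ (hf _ hz)
    have h2 : arPoly R φ (fun i => (r : ℂ) * torusPoint t i) ≠ 0 := hball (by
      rw [dist_zero_right, pi_norm_lt_iff hε]
      intro i
      rwa [norm_mul, norm_torusPoint, mul_one, Complex.norm_real, Real.norm_of_nonneg hr0.le])
    rwa [hq _ hz h2, mul_div_cancel₀ _ h2, sub_self] at h1)
  exact fun k => sub_eq_zero.1 (congrFun h k)

theorem exists_memHardy_hasExpansion {d : ℕ} {α : (Fin d → ℕ) → ℂ}
    (hα : Summable fun k => ‖α k‖ ^ 2) : ∃ f, MemHardy f ∧ HasExpansion f α := by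
  have hC : ∀ k, ‖α k‖ ≤ Real.sqrt (∑' k, ‖α k‖ ^ 2) := fun k =>
    Real.le_sqrt_of_sq_le (hα.le_tsum k fun _ _ => sq_nonneg _)
  have hexp : HasExpansion (fun z => ∑' k, α k * monomial z k) α := fun z hz =>
    (summable_mul_monomial hC hz).hasSum
  exact ⟨_, ⟨differentiableOn_tsum_monomial hC, hardyNormSq_lt_top hexp hα⟩, hexp⟩

/-! ### The rectangular sum as a measurable functional, and the linear field. -/

theorem HasRectSum.rectSum_eq {d : ℕ} {x : (Fin d → ℕ) → ℂ} {l : ℂ} (h : HasRectSum x l) :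
    rectSum x = l := by
  have hex : ∃ l, HasRectSum x l := ⟨l, h⟩
  rw [rectSum, dif_pos hex]
  exact tendsto_nhds_unique hex.choose_spec h

theorem hasRectSum_rectSum {d : ℕ} {x : (Fin d → ℕ) → ℂ} (h : ∃ l, HasRectSum x l) :
    HasRectSum x (rectSum x) := by
  obtain ⟨l, hl⟩ := h
  rwa [hl.rectSum_eq]

theorem HasRectSum.neg {d : ℕ} {x : (Fin d → ℕ) → ℂ} {l : ℂ} (h : HasRectSum x l) :
    HasRectSum (fun k => -x k) (-l) := by
  refine (Tendsto.neg h).congr fun N => ?_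
  simp only [rectPartialSum, Finset.sum_neg_distrib]

theorem rectSum_neg {d : ℕ} (x : (Fin d → ℕ) → ℂ) : rectSum (fun k => -x k) = -rectSum x := by
  by_cases h : ∃ l, HasRectSum x l
  · exact (hasRectSum_rectSum h).neg.rectSum_eq
  · have h' : ¬ ∃ l, HasRectSum (fun k => -x k) l := fun ⟨l, hl⟩ =>
      h ⟨-l, by simpa only [neg_neg] using hl.neg⟩
    rw [rectSum, rectSum, dif_neg h, dif_neg h', neg_zero]

/-- The set of convergence is measurable, and partial sums cut off to it converge everywhere; the
cutoff value agrees with the default value `0`. -/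
theorem measurable_rectSum {d : ℕ} : Measurable (rectSum : ((Fin d → ℕ) → ℂ) → ℂ) := by
  have hE : MeasurableSet {x : (Fin d → ℕ) → ℂ | ∃ l, HasRectSum x l} :=
    MeasureTheory.measurableSet_exists_tendsto (f := fun N (x : (Fin d → ℕ) → ℂ) =>
      rectPartialSum x N) fun N => measurable_rectPartialSum N
  refine measurable_of_tendsto_metrizable' (atTop : Filter (Fin d → ℕ))
    (fun N => (measurable_rectPartialSum N).indicator hE) (tendsto_pi_nhds.2 fun x => ?_)
  by_cases h : x ∈ {x : (Fin d → ℕ) → ℂ | ∃ l, HasRectSum x l}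
  · simp only [Set.indicator_of_mem h]
    exact hasRectSum_rectSum h
  · simp only [Set.indicator_of_notMem h]
    have h' : ¬ ∃ l, HasRectSum x l := h
    rw [rectSum, dif_neg h']
    exact tendsto_const_nhds

theorem measurable_rectSum_comp {d : ℕ} {Ω : Type*} {m : MeasurableSpace Ω}
    {X : (Fin d → ℕ) → Ω → ℂ} (hX : ∀ k, Measurable (X k)) :
    Measurable fun ω => rectSum fun k => X k ω :=
  measurable_rectSum.comp (measurable_pi_iff.2 hX)

/-- The linear field with coefficients `α` driven by `z`. -/
noncomputable def linearField {d : ℕ} (α : (Fin d → ℕ) → ℂ) (z : (Fin d → ℤ) → ℂ)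
    (t : Fin d → ℤ) : ℂ :=
  rectSum fun k => α k * z (back t k)

theorem measurable_linearField {d : ℕ} (α : (Fin d → ℕ) → ℂ) : Measurable (linearField α) :=
  measurable_pi_iff.2 fun _ => measurable_rectSum.comp
    (measurable_pi_iff.2 fun _ => (measurable_pi_apply _).const_mul _)

/-- Shift equivariance transports stationarity from the noise to the linear field. -/
theorem linearField_shift {d : ℕ} (α : (Fin d → ℕ) → ℂ) (z : (Fin d → ℤ) → ℂ)
    (t h : Fin d → ℤ) : linearField α (fun s => z (s + h)) t = linearField α z (t + h) := by
  simp only [linearField, back_add_shift]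

theorem linearField_neg {d : ℕ} (α : (Fin d → ℕ) → ℂ) (z : (Fin d → ℤ) → ℂ)
    (t : Fin d → ℤ) : linearField α (fun s => -z s) t = -linearField α z t := by
  simp only [linearField, mul_neg, rectSum_neg]

theorem shiftedSum_eq_rectPartialSum {d : ℕ} (α x : (Fin d → ℕ) → ℂ) {N n : Fin d → ℕ}
    (h : n ≤ N) : shiftedSum α x N n = rectPartialSum (fun k => α k * x (n + k)) (N - n) := by
  symm
  refine Finset.sum_bij' (fun k _ => n + k) (fun k _ => k - n) (fun k hk => ?_) (fun k hk => ?_)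
    (fun k _ => add_tsub_cancel_left _ _) (fun k hk => ?_) fun k _ => ?_
  · exact Finset.mem_Icc.2 ⟨le_self_add, (le_tsub_iff_add_le h).1 (Finset.mem_Iic.1 hk)⟩
  · exact Finset.mem_Iic.2 (tsub_le_tsub_right (Finset.mem_Icc.1 hk).2 n)
  · exact add_tsub_cancel_of_le (Finset.mem_Icc.1 hk).1
  · rw [add_tsub_cancel_left]

theorem tendsto_shiftedSum {d : ℕ} {α x : (Fin d → ℕ) → ℂ} {n : Fin d → ℕ} {l : ℂ}
    (h : HasRectSum (fun k => α k * x (n + k)) l) :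
    Tendsto (fun N => shiftedSum α x N n) atTop (𝓝 l) := by
  have h1 : Tendsto (fun N : Fin d → ℕ => N - n) atTop atTop :=
    tendsto_atTop.2 fun M => by
      filter_upwards [eventually_ge_atTop (M + n)] with N hN i
      have : M i + n i ≤ N i := hN i
      simp only [Pi.sub_apply]
      omega
  refine (h.comp h1).congr' ?_
  filter_upwards [eventually_ge_atTop n] with N hN
  exact (shiftedSum_eq_rectPartialSum α x hN).symm

/-- Let `N` tend to infinity in `IsRecursive.shiftedSum_eq` at `j = 0`: the truncated sum started at
`n` tends to the field at `t - n`, and the cutoffs are eventually inactive. -/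
theorem IsRecursive.linearField_solves {d : ℕ} {R S : Finset (Fin d → ℕ)}
    {φ θ α : (Fin d → ℕ) → ℂ} (hα : IsRecursive R S φ θ α) {z : (Fin d → ℤ) → ℂ}
    (hz : ∀ t, ∃ l, HasRectSum (fun k => α k * z (back t k)) l) (t : Fin d → ℤ) :
    linearField α z t - ∑ n ∈ R, φ n * linearField α z (back t n) =
      z t + ∑ n ∈ S, θ n * z (back t n) := by
  classical
  set x : (Fin d → ℕ) → ℂ := fun k => z (back t k) with hx
  have hlim : ∀ n, Tendsto (fun N => shiftedSum α x N n) atTop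
      (𝓝 (linearField α z (back t n))) := fun n => by
    refine tendsto_shiftedSum ?_
    have := hasRectSum_rectSum (hz (back t n))
    simpa only [linearField, back_add] using this
  have hite : ∀ n : Fin d → ℕ, Tendsto (fun N => if n ≤ N then x n else 0) atTop (𝓝 (x n)) :=
    fun n => tendsto_const_nhds.congr' (by
      filter_upwards [eventually_ge_atTop n] with N hN
      rw [if_pos hN])
  have h1 := (tendsto_finsetSum R fun n _ => (hlim (0 + n)).const_mul (φ n)).add
    ((hite 0).add (tendsto_finsetSum S fun n _ => (hite (0 + n)).const_mul (θ n)))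
  have h2 := tendsto_nhds_unique (hlim 0)
    (h1.congr fun N => (hα.shiftedSum_eq x N 0).symm)
  simp only [zero_add, back_zero, hx] at h2
  rw [h2]
  ring

/-! ### Existence and uniqueness of the symmetric causal solution. -/

section Noise

variable {d : ℕ} {Ω : Type*} [mΩ : MeasurableSpace Ω] {μ : Measure Ω} [IsProbabilityMeasure μ]
  {R S : Finset (Fin d → ℕ)} {φ θ α : (Fin d → ℕ) → ℂ} {Z Y : (Fin d → ℤ) → Ω → ℂ}

omit [IsProbabilityMeasure μ] in
theorem isCausalSolution_linearField (hZ : IsIIDNoise μ Z) (hα : IsRecursive R S φ θ α)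
    (hconv : ∀ t, ConvergesRectAS μ (fun k ω => α k * Z (back t k) ω)) :
    IsCausalSolution μ R S φ θ Z fun t ω => linearField α (fun s => Z s ω) t where
  stationary h := by
    have h1 : IdentDistrib (fun ω s => Z (s + h) ω) (fun ω s => Z s ω) μ μ :=
      IdentDistrib.pi (fun s => hZ.ident (s + h) s) (hZ.indep.precomp (add_left_injective h))
        hZ.indep
    have h2 := h1.comp (measurable_linearField α)
    convert! h2 using 1
    funext ω t
    exact (linearField_shift α (fun s => Z s ω) t h).symm
  solves t := by
    filter_upwards [ae_all_iff.2 hconv] with ω hω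
    exact hα.linearField_solves (z := fun s => Z s ω) hω t
  causal t := by
    refine measurable_rectSum_comp fun k => ?_
    have hk : back t k ∈ Set.Iic t := (le_iff_exists_back _ _).2 ⟨k, rfl⟩
    exact (measurable_fieldSigma Z hk).const_mul _

omit [IsProbabilityMeasure μ] in
theorem isSymmetric_linearField (hZ : IsIIDNoise μ Z) (hs : IsSymmetric μ Z)
    (α : (Fin d → ℕ) → ℂ) : IsSymmetric μ fun t ω => linearField α (fun s => Z s ω) t := by
  have h1 : IdentDistrib (fun ω s => Z s ω) (fun ω s => -Z s ω) μ μ :=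
    IdentDistrib.pi (fun s => hZ.symmetric hs s) hZ.indep
      (hZ.indep.comp (fun _ z => -z) fun _ => measurable_neg)
  have h2 := h1.comp ((measurable_pi_apply 0).comp (measurable_linearField α))
  simp only [Function.comp_def, linearField_neg] at h2
  exact h2

omit [IsProbabilityMeasure μ] in
theorem IsCausalSolution.identDistrib (hY : IsCausalSolution μ R S φ θ Z Y) (t : Fin d → ℤ) :
    IdentDistrib (Y t) (Y 0) μ μ := by
  simpa only [Function.comp_def, zero_add] using (hY.stationary t).comp (measurable_pi_apply 0)

omit [IsProbabilityMeasure μ] in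
theorem IsCausalSolution.symmetric (hY : IsCausalSolution μ R S φ θ Z Y)
    (hs : IsSymmetric μ Y) (t : Fin d → ℤ) : IdentDistrib (Y t) (fun ω => -Y t ω) μ μ :=
  ((hY.identDistrib t).trans hs).trans ((hY.identDistrib t).symm.comp measurable_neg)

omit mΩ in
theorem past_eq_iSup_nearBox (Z : (Fin d → ℤ) → Ω → ℂ) (t : Fin d → ℤ) :
    past Z t = ⨆ N, fieldSigma Z (nearBox t N) := by
  refine le_antisymm (iSup₂_le fun s hs => ?_) (iSup_le fun N => fieldSigma_mono Z ?_)
  · obtain ⟨k, rfl⟩ := (le_iff_exists_back _ _).1 hs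
    exact (measurable_fieldSigma Z (back_mem_nearBox.2 le_rfl)).comap_le.trans
      (le_iSup (fun N => fieldSigma Z (nearBox t N)) k)
  · rintro _ ⟨k, _, rfl⟩
    exact (le_iff_exists_back _ _).2 ⟨k, rfl⟩

/-- A zero-one law: every event of `m` has probability `0` or `1`, and countably many measurable
sets separate points of `ℂ`. -/
theorem exists_ae_eq_const_of_indep_self {m : MeasurableSpace Ω} {D : Ω → ℂ}
    (hD : Measurable[m] D) (hi : Indep m m μ) (hm : m ≤ mΩ) :
    ∃ c, ∀ᵐ ω ∂μ, D ω = c := by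
  refine Filter.exists_eventuallyEq_const_of_forall_separating (l := ae μ) MeasurableSet
    fun U hU => ?_
  rcases measure_eq_zero_or_one_of_indep_self hi (hD hU) with h | h
  · right
    exact measure_eq_zero_iff_ae_notMem.1 h
  · left
    exact (mem_ae_iff_prob_eq_one (hm _ (hD hU))).2 h

/-- Two causal solutions differ at every lattice point by a constant. -/
theorem IsCausalSolution.exists_sub_eq_const {Y' : (Fin d → ℤ) → Ω → ℂ} (hR : 0 ∉ R)
    (hZ : IsIIDNoise μ Z) (hY : IsCausalSolution μ R S φ θ Z Y)
    (hY' : IsCausalSolution μ R S φ θ Z Y') (t : Fin d → ℤ) :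
    ∃ c, ∀ᵐ ω ∂μ, Y' t ω - Y t ω = c := by
  obtain ⟨α, hα⟩ := exists_isRecursive S hR φ θ
  set D : Ω → ℂ := fun ω => Y' t ω - Y t ω with hD
  have hDm : Measurable[past Z t] D := (hY'.causal t).sub (hY.causal t)
  have hpast := fieldSigma_le hZ.measurable (Set.Iic t)
  have hnear : ∀ N, Indep (fieldSigma Z (nearBox t N)) (MeasurableSpace.comap D inferInstance) μ := by
    intro N
    -- Both remainders subtract the same partial sum, so `D` is a difference of quantities depending
    -- only on the noise outside the box.
    have h1 : AEStronglyMeasurable[fieldSigma Z (nearBox t N)ᶜ] D μ := by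
      refine ((hY'.aestronglyMeasurable_remainder hR hα t N).fun_sub
        (hY.aestronglyMeasurable_remainder hR hα t N)).congr (ae_of_all _ fun ω => ?_)
      simp only [hD]
      ring
    refine (Indep_iff _ _ _).2 fun A B hA hB => ?_
    obtain ⟨U, hU, rfl⟩ := hB
    have h2 : D ⁻¹' U =ᵐ[μ] h1.mk D ⁻¹' U := by
      filter_upwards [h1.ae_eq_mk] with ω hω
      change (D ω ∈ U) = (h1.mk D ω ∈ U)
      rw [hω]
    rw [measure_congr h2, measure_congr ((ae_eq_refl A).inter h2)]
    exact (Indep_iff _ _ _).1 (indep_fieldSigma hZ.measurable hZ.indep disjoint_compl_right) A _ hA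
      (h1.stronglyMeasurable_mk.measurable hU)
  have hdir : Directed (· ≤ ·) fun N => fieldSigma Z (nearBox t N) :=
    Monotone.directed_le fun M N hMN =>
      fieldSigma_mono Z (Set.image_mono (Set.Iic_subset_Iic.2 hMN))
  -- The boxes are directed and exhaust the past, which contains the σ-algebra of `D`; hence `D` is
  -- independent of itself.
  have hind := indep_iSup_of_directed_le hnear (fun N => fieldSigma_le hZ.measurable _)
    (hDm.comap_le.trans hpast) hdir
  rw [← past_eq_iSup_nearBox] at hind
  exact exists_ae_eq_const_of_indep_self (comap_measurable D)
    (indep_of_indep_of_le_left hind hDm.comap_le) (hDm.comap_le.trans hpast)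

/-- A symmetric real random variable stays symmetric only under the trivial translation. -/
theorem eq_zero_of_symmetric_add_const {X : Ω → ℝ} {a : ℝ} (hX : Measurable X)
    (hs : IdentDistrib X (fun ω => -X ω) μ μ)
    (hs' : IdentDistrib (fun ω => X ω + a) (fun ω => -(X ω + a)) μ μ) : a = 0 := by
  by_contra ha
  have hp : IsProbabilityMeasure (μ.map X) := Measure.isProbabilityMeasure_map hX.aemeasurable
  obtain ⟨δ, hδ, hδX⟩ := exists_forall_half_le_norm_charFun (μ.map X)
  have ha0 : 0 < |a| := abs_pos.2 ha
  -- Small enough that the characteristic function of `X` does not vanish at `u`, and that `|u * a|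
  -- ≤ 1 < π`, so a vanishing sine forces `u * a = 0`.
  set u : ℝ := min δ (1 / |a|) with hu
  have hu0 : 0 < u := lt_min hδ (by positivity)
  have h1 : 1 / 2 ≤ ‖charFun (μ.map X) u‖ := hδX u (by
    rw [abs_of_pos hu0]
    exact min_le_left _ _)
  have h2 := charFun_map_of_symmetric (hX.add_const a) hs' u
  have h3 : μ.map (fun ω => X ω + a) = (μ.map X).map fun x => x + a := by
    rw [Measure.map_map (by fun_prop) hX]
    rfl
  rw [h3, charFun_map_add_const, charFun_map_of_symmetric hX hs u] at h2
  rw [charFun_map_of_symmetric hX hs u, Complex.norm_real] at h1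
  set c := ∫ ω, Real.cos (u * X ω) ∂μ
  have hc : c ≠ 0 := fun h => by
    rw [h, norm_zero] at h1
    norm_num at h1
  -- Both characteristic functions are real by symmetry, whereas the translation multiplies by `exp
  -- (i u a)`; compare imaginary parts.
  have h4 : c * Real.sin (inner ℝ a u) = 0 := by
    have := congrArg Complex.im h2
    rwa [Complex.im_ofReal_mul, Complex.exp_ofReal_mul_I_im, Complex.ofReal_im] at this
  have h5 : inner ℝ a u = u * a := by simp
  rw [h5] at h4
  have h6 : |u * a| ≤ 1 := by
    rw [abs_mul, abs_of_pos hu0, ← le_div_iff₀ ha0]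
    exact min_le_right _ _
  have h7 := (Real.sin_eq_zero_iff_of_lt_of_lt (x := u * a)
    (by linarith [(abs_le.1 h6).1, Real.pi_gt_three])
    (by linarith [(abs_le.1 h6).2, Real.pi_gt_three])).1 ((mul_eq_zero.1 h4).resolve_left hc)
  exact (mul_ne_zero hu0.ne' ha) h7

theorem IsCausalSolution.ae_eq_of_isSymmetric {Y' : (Fin d → ℤ) → Ω → ℂ} (hR : 0 ∉ R)
    (hZ : IsIIDNoise μ Z) (hY : IsCausalSolution μ R S φ θ Z Y) (hs : IsSymmetric μ Y)
    (hY' : IsCausalSolution μ R S φ θ Z Y') (hs' : IsSymmetric μ Y') (t : Fin d → ℤ) :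
    Y' t =ᵐ[μ] Y t := by
  obtain ⟨c, hc⟩ := hY.exists_sub_eq_const hR hZ hY' t
  have hYm : Measurable (Y t) :=
    (hY.causal t).mono (fieldSigma_le hZ.measurable (Set.Iic t)) le_rfl
  have hL : ∀ L : ℂ →L[ℝ] ℝ, L c = 0 := fun L => by
    have hLm : Measurable L := L.continuous.measurable
    have h1 := (hY.symmetric hs t).comp hLm
    have h2 := (hY'.symmetric hs' t).comp hLm
    simp only [Function.comp_def, map_neg] at h1 h2
    have h3 : (fun ω => L (Y' t ω)) =ᵐ[μ] fun ω => L (Y t ω) + L c := by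
      filter_upwards [hc] with ω hω
      rw [← hω, map_sub]
      ring
    have hm : Measurable fun ω => L (Y t ω) := hLm.comp hYm
    have h4 : IdentDistrib (fun ω => L (Y t ω) + L c) (fun ω => L (Y' t ω)) μ μ :=
      IdentDistrib.of_ae_eq (hm.add_const _).aemeasurable h3.symm
    exact eq_zero_of_symmetric_add_const hm h1 ((h4.trans h2).trans (h4.symm.comp measurable_neg))
  have hc0 : c = 0 := Complex.ext (hL Complex.reCLM) (hL Complex.imCLM)
  filter_upwards [hc] with ω hω
  rw [hc0] at hω
  exact sub_eq_zero.1 hω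

end Noise

end SpatialARMA

theorem mainTheorem7 {d : ℕ} (hd : 0 < d) {Ω : Type*} [MeasurableSpace Ω]
    (μ : Measure Ω) [IsProbabilityMeasure μ]
    (R S : Finset (Fin d → ℕ)) (hR : 0 ∉ R) (hS : 0 ∉ S) (φ θ : (Fin d → ℕ) → ℂ)
    (Z : (Fin d → ℤ) → Ω → ℂ)
    (hZ : SpatialARMA.IsIIDNoise μ Z)
    (hZdet : ¬ SpatialARMA.IsDeterministic μ Z)
    (hZsymm : SpatialARMA.IsSymmetric μ Z) :
    ((∃ Y : (Fin d → ℤ) → Ω → ℂ, SpatialARMA.IsCausalSolution μ R S φ θ Z Y) ↔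
      ∃ f : (Fin d → ℂ) → ℂ,
        SpatialARMA.IsQuotient R S φ θ f ∧ SpatialARMA.MemHardy f ∧
        ∃ α : (Fin d → ℕ) → ℂ, SpatialARMA.HasExpansion f α ∧
          ∀ t : Fin d → ℤ, SpatialARMA.ConvergesRectAS μ
            (fun k ω => α k * Z (SpatialARMA.back t k) ω)) ∧
    (∀ (f : (Fin d → ℂ) → ℂ) (α : (Fin d → ℕ) → ℂ),
      SpatialARMA.IsQuotient R S φ θ f → SpatialARMA.MemHardy f →
      SpatialARMA.HasExpansion f α →
      (∀ t : Fin d → ℤ, SpatialARMA.ConvergesRectAS μ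
        (fun k ω => α k * Z (SpatialARMA.back t k) ω)) →
      ∀ Y : (Fin d → ℤ) → Ω → ℂ,
        (Y = fun t ω => SpatialARMA.rectSum (fun k => α k * Z (SpatialARMA.back t k) ω)) →
        (SpatialARMA.IsCausalSolution μ R S φ θ Z Y ∧ SpatialARMA.IsSymmetric μ Y) ∧
        ∀ Y' : (Fin d → ℤ) → Ω → ℂ,
          SpatialARMA.IsCausalSolution μ R S φ θ Z Y' → SpatialARMA.IsSymmetric μ Y' →
          ∀ t, Y' t =ᵐ[μ] Y t) := by

  open SpatialARMA in
  have hback : ∀ (f : (Fin d → ℂ) → ℂ) (α : (Fin d → ℕ) → ℂ), IsQuotient R S φ θ f →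
      HasExpansion f α → (∀ t, ConvergesRectAS μ fun k ω => α k * Z (back t k) ω) →
      IsCausalSolution μ R S φ θ Z (fun t ω => rectSum fun k => α k * Z (back t k) ω) :=
    fun f α hq hf hconv => isCausalSolution_linearField hZ (hq.isRecursive hR hf) hconv
  refine ⟨⟨?_, ?_⟩, ?_⟩
  · rintro ⟨Y, hY⟩
    -- The coefficients come first, from the formal recursion; `f` is then defined as their power
    -- series, once square summability is known.
    obtain ⟨α, hα⟩ := SpatialARMA.exists_isRecursive S hR φ θ
    obtain ⟨f, hH, hf⟩ := SpatialARMA.exists_memHardy_hasExpansion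
      (hY.summable_norm_sq hR hZ hZsymm hZdet hα)
    exact ⟨f, hα.isQuotient hf, hH, α, hf, hY.convergesRectAS hR hZ hZsymm hα⟩
  · rintro ⟨f, hq, -, α, hf, hconv⟩
    exact ⟨_, hback f α hq hf hconv⟩
  · rintro f α hq - hf hconv Y rfl
    have hsol := hback f α hq hf hconv
    have hsymm := SpatialARMA.isSymmetric_linearField hZ hZsymm α
    exact ⟨⟨hsol, hsymm⟩, fun Y' hY' hs' => hsol.ae_eq_of_isSymmetric hR hZ hsymm hY' hs'⟩
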